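/- Let $G$ be a complex reductive linear algebraic group. An affine $G$-variety $X$ is an affine scheme of finite type over $\mathbb{C}$ (not necessarily reduced or irreducible) with an algebraic action of $G$; its quotient is $X/\!/G=\operatorname{Spec}\mathcal O(X)^G$, with quotient map $p\colon X\to X/\!/G$, and a subset $S\subseteq X$ is $G$-saturated if $S=p^{-1}(p(S))$. For $m\in\{0,1,2,\dots\}\cup\{\infty\}$ let $X_m$ be the $m$-th jet scheme of $X$ (the arc space if $m=\infty$): its $A$-points are the $A[t]/(t^{m+1})$-points (the $A[[t]]$-points if $m=\infty$) of $X$, for every $\mathbb{C}$-algebra $A$. The group $G_m$ acts on $X_m$, and $p$ induces a homomorphism $p_m^*\colon\mathcal O((X/\!/G)_m)\to\mathcal O(X_m)^{G_m}$. Call $X$ $m$-very good if $p_m^*$ is an isomorphism, $m$-good if $p_m^*$ is surjective, and $D$-finite if $\mathcal O(X_\infty)^{G_\infty}$ is finitely generated as a differential algebra, with respect to the canonical derivation $D$ of $\mathcal O(X_\infty)$. (1) Let $X$ be an affine $G$-variety and $X=\bigcup_\alpha X_\alpha$ a cover by affine, Zariski open, $G$-saturated subsets (with any index set). Then, for every $m$,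 $X$ is $m$-very good (respectively $m$-good) if and only if every $X_\alpha$ is $m$-very good (respectively $m$-good); and $X$ is $D$-finite if and only if every $X_\alpha$ is $D$-finite. (2) Let $W$ be a $G$-module, that is, a finite dimensional rational representation of $G$, let $f\in\mathcal O(W)^G$ with $f(0)\ne 0$, and let $U=W_f=\{w\in W: f(w)\neq 0\}$. Then, for every $m$, $W$ is $m$-very good (respectively $m$-good) if and only if $U$ is $m$-very good (respectively $m$-good); and $W$ is $D$-finite if and only if $U$ is $D$-finite. -/

import Mathlib

open scoped TensorProduct

noncomputable section

namespace JetInvariant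

universe u v w

section Jets

/-- The ideal of power series over `A` whose coefficients of degree `≤ m` vanish. -/
def truncIdeal (A : Type u) [CommRing A] (m : ℕ∞) : Ideal (PowerSeries A) where
  carrier := {φ | ∀ i : ℕ, (i : ℕ∞) ≤ m → PowerSeries.coeff i φ = 0}
  add_mem' := fun ha hb i hi => by rw [map_add, ha i hi, hb i hi, add_zero]
  zero_mem' := fun i _ => by simp
  smul_mem' := fun c φ hφ i hi => by
    rw [smul_eq_mul, PowerSeries.coeff_mul]
    refine Finset.sum_eq_zero fun p hp => ?_
    have hle : p.2 ≤ i := Finset.HasAntidiagonal.antidiagonal.snd_le hp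
    rw [hφ p.2 (le_trans (by exact_mod_cast hle) hi), mul_zero]

theorem mem_truncIdeal {A : Type u} [CommRing A] {m : ℕ∞} {φ : PowerSeries A} :
    φ ∈ truncIdeal A m ↔ ∀ i : ℕ, (i : ℕ∞) ≤ m → PowerSeries.coeff i φ = 0 := Iff.rfl

theorem truncIdeal_natCast (A : Type u) [CommRing A] (m : ℕ) :
    truncIdeal A (m : ℕ∞) = Ideal.span {(PowerSeries.X : PowerSeries A) ^ (m + 1)} := by
  ext φ
  rw [Ideal.mem_span_singleton, PowerSeries.X_pow_dvd_iff, mem_truncIdeal]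
  exact forall_congr' fun i => by rw [Nat.cast_le, Nat.lt_succ_iff]

theorem truncIdeal_top (A : Type u) [CommRing A] : truncIdeal A ⊤ = ⊥ := by
  ext φ
  rw [Ideal.mem_bot, mem_truncIdeal, PowerSeries.ext_iff]
  simp

/-- `A[t] / (t ^ (m + 1))` for finite `m`, and `A[[t]]` for `m = ∞`. -/
def TruncSeries (A : Type u) [CommRing A] (m : ℕ∞) : Type u :=
  PowerSeries A ⧸ truncIdeal A m

instance (A : Type u) [CommRing A] (m : ℕ∞) : CommRing (TruncSeries A m) :=
  inferInstanceAs (CommRing (PowerSeries A ⧸ truncIdeal A m))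

instance (A : Type u) [CommRing A] [Algebra ℂ A] (m : ℕ∞) : Algebra ℂ (TruncSeries A m) :=
  inferInstanceAs (Algebra ℂ (PowerSeries A ⧸ truncIdeal A m))

/-- The class of a power series. -/
def TruncSeries.mk (A : Type u) [CommRing A] (m : ℕ∞) : PowerSeries A →+* TruncSeries A m :=
  Ideal.Quotient.mk (truncIdeal A m)

theorem TruncSeries.mk_surjective (A : Type u) [CommRing A] (m : ℕ∞) :
    Function.Surjective (TruncSeries.mk A m) :=
  Ideal.Quotient.mk_surjective

theorem TruncSeries.mk_algebraMap (A : Type u) [CommRing A] [Algebra ℂ A] (m : ℕ∞) (c : ℂ) :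
    TruncSeries.mk A m (algebraMap ℂ (PowerSeries A) c) = algebraMap ℂ (TruncSeries A m) c :=
  rfl

/-- Functoriality of `A ↦ A[t] / (t ^ (m + 1))`. -/
def TruncSeries.map {A : Type u} {B : Type v} [CommRing A] [Algebra ℂ A] [CommRing B]
    [Algebra ℂ B] (m : ℕ∞) (g : A →ₐ[ℂ] B) : TruncSeries A m →ₐ[ℂ] TruncSeries B m :=
  Ideal.quotientMapₐ _ (PowerSeries.mapAlgHom g) fun φ hφ i hi => by
    rw [PowerSeries.mapAlgHom_apply, PowerSeries.coeff_map, hφ i hi, map_zero]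

/-- The `i`-th coefficient of a truncated power series (`0` beyond the order of truncation). -/
def TruncSeries.coeff (A : Type u) [CommRing A] (m : ℕ∞) (i : ℕ) : TruncSeries A m →+ A :=
  QuotientAddGroup.lift _
    (if (i : ℕ∞) ≤ m then (PowerSeries.coeff (R := A) i).toAddMonoidHom else 0)
    fun φ hφ => by
      split_ifs with h
      · exact hφ i h
      · rfl

theorem TruncSeries.coeff_mk {A : Type u} [CommRing A] {m : ℕ∞} {i : ℕ} (hi : (i : ℕ∞) ≤ m)
    (φ : PowerSeries A) :
    TruncSeries.coeff A m i (TruncSeries.mk _ m φ) = PowerSeries.coeff i φ := by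
  change (if (i : ℕ∞) ≤ m then (PowerSeries.coeff (R := A) i).toAddMonoidHom else 0) φ = _
  rw [if_pos hi]; rfl

theorem TruncSeries.coeff_of_lt {A : Type u} [CommRing A] {m : ℕ∞} {i : ℕ} (hi : m < i)
    (x : TruncSeries A m) : TruncSeries.coeff A m i x = 0 := by
  obtain ⟨φ, rfl⟩ := TruncSeries.mk_surjective A m x
  change (if (i : ℕ∞) ≤ m then (PowerSeries.coeff (R := A) i).toAddMonoidHom else 0) φ = _
  rw [if_neg (not_le.2 hi)]; rfl

theorem TruncSeries.ext {A : Type u} [CommRing A] {m : ℕ∞} {x y : TruncSeries A m}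
    (h : ∀ i : ℕ, (i : ℕ∞) ≤ m → TruncSeries.coeff A m i x = TruncSeries.coeff A m i y) :
    x = y := by
  obtain ⟨φ, rfl⟩ := TruncSeries.mk_surjective A m x
  obtain ⟨ψ, rfl⟩ := TruncSeries.mk_surjective A m y
  refine Ideal.Quotient.eq.2 fun i hi => ?_
  have := h i hi
  rw [TruncSeries.coeff_mk hi, TruncSeries.coeff_mk hi] at this
  rw [map_sub, this, sub_self]

theorem TruncSeries.coeff_map {A : Type u} {B : Type v} [CommRing A] [Algebra ℂ A] [CommRing B]
    [Algebra ℂ B] {m : ℕ∞} (g : A →ₐ[ℂ] B) (i : ℕ) (x : TruncSeries A m) :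
    TruncSeries.coeff B m i (TruncSeries.map m g x) = g (TruncSeries.coeff A m i x) := by
  by_cases hi : (i : ℕ∞) ≤ m
  · obtain ⟨φ, rfl⟩ := TruncSeries.mk_surjective A m x
    change TruncSeries.coeff B m i (TruncSeries.mk _ m (PowerSeries.mapAlgHom g φ)) = _
    rw [TruncSeries.coeff_mk hi, TruncSeries.coeff_mk hi, PowerSeries.mapAlgHom_apply,
      PowerSeries.coeff_map]
    rfl
  · rw [TruncSeries.coeff_of_lt (not_le.1 hi), TruncSeries.coeff_of_lt (not_le.1 hi), map_zero]

theorem TruncSeries.coeff_mul {A : Type v} [CommRing A] {m : ℕ∞} {i : ℕ} (hi : (i : ℕ∞) ≤ m)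
    (x y : TruncSeries A m) : TruncSeries.coeff A m i (x * y) =
      ∑ p ∈ Finset.HasAntidiagonal.antidiagonal i, TruncSeries.coeff A m p.1 x * TruncSeries.coeff A m p.2 y := by
  obtain ⟨φ, rfl⟩ := TruncSeries.mk_surjective A m x
  obtain ⟨ψ, rfl⟩ := TruncSeries.mk_surjective A m y
  rw [← map_mul, TruncSeries.coeff_mk hi, PowerSeries.coeff_mul]
  refine Finset.sum_congr rfl fun p hp => ?_
  have h1 : p.1 ≤ i := Finset.HasAntidiagonal.antidiagonal.fst_le hp
  have h2 : p.2 ≤ i := Finset.HasAntidiagonal.antidiagonal.snd_le hp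
  rw [TruncSeries.coeff_mk (le_trans (by exact_mod_cast h1) hi),
    TruncSeries.coeff_mk (le_trans (by exact_mod_cast h2) hi)]

theorem TruncSeries.coeff_algebraMap {A : Type v} [CommRing A] [Algebra ℂ A] {m : ℕ∞} (i : ℕ)
    (c : ℂ) : TruncSeries.coeff A m i (algebraMap ℂ (TruncSeries A m) c) =
      if i = 0 then algebraMap ℂ A c else 0 := by
  by_cases hi : (i : ℕ∞) ≤ m
  · rw [← TruncSeries.mk_algebraMap, TruncSeries.coeff_mk hi, PowerSeries.algebraMap_apply, PowerSeries.coeff_C]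
  · rw [TruncSeries.coeff_of_lt (not_le.1 hi), if_neg]
    rintro rfl
    simp at hi

variable (R : Type u) [CommRing R] [Algebra ℂ R]

/-- The defining relations of the ring of `m`-jets: the variable `(i, f)` stands for the `i`-th
coefficient of the image of `f` under the universal jet `R → R_m[t] / (t ^ (m + 1))`. -/
inductive JetRel (m : ℕ∞) : MvPolynomial (ℕ × R) ℂ → MvPolynomial (ℕ × R) ℂ → Prop
  | add (i : ℕ) (f g : R) :
      JetRel m (MvPolynomial.X (i, f + g)) (MvPolynomial.X (i, f) + MvPolynomial.X (i, g))
  | const (i : ℕ) (c : ℂ) :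
      JetRel m (MvPolynomial.X (i, algebraMap ℂ R c)) (if i = 0 then MvPolynomial.C c else 0)
  | mul (i : ℕ) (hi : (i : ℕ∞) ≤ m) (f g : R) :
      JetRel m (MvPolynomial.X (i, f * g))
        (∑ p ∈ Finset.HasAntidiagonal.antidiagonal i, MvPolynomial.X (p.1, f) * MvPolynomial.X (p.2, g))
  | high (i : ℕ) (hi : m < (i : ℕ∞)) (f : R) : JetRel m (MvPolynomial.X (i, f)) 0

/-- The ideal of relations among the coefficients of a jet. -/
def jetIdeal (m : ℕ∞) : Ideal (MvPolynomial (ℕ × R) ℂ) :=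
  Ideal.span {p | ∃ a b, JetRel R m a b ∧ p = a - b}

/-- The coordinate ring `R_m` of the `m`-th jet scheme of `Spec R`
(of the arc space if `m = ∞`). -/
def JetRing (m : ℕ∞) : Type u := MvPolynomial (ℕ × R) ℂ ⧸ jetIdeal R m

instance (m : ℕ∞) : CommRing (JetRing R m) :=
  inferInstanceAs (CommRing (MvPolynomial (ℕ × R) ℂ ⧸ jetIdeal R m))

instance (m : ℕ∞) : Algebra ℂ (JetRing R m) :=
  inferInstanceAs (Algebra ℂ (MvPolynomial (ℕ × R) ℂ ⧸ jetIdeal R m))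

/-- The class of a polynomial in the coordinates of jets. -/
def JetRing.mk (m : ℕ∞) : MvPolynomial (ℕ × R) ℂ →ₐ[ℂ] JetRing R m :=
  Ideal.Quotient.mkₐ ℂ (jetIdeal R m)

theorem JetRing.mk_surjective (m : ℕ∞) : Function.Surjective (JetRing.mk R m) :=
  Ideal.Quotient.mkₐ_surjective ℂ _

theorem JetRing.mk_eq_zero {m : ℕ∞} {a : MvPolynomial (ℕ × R) ℂ} :
    JetRing.mk R m a = 0 ↔ a ∈ jetIdeal R m :=
  Ideal.Quotient.eq_zero_iff_mem

variable {R}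

/-- The `i`-th coefficient of the universal jet of `f`. -/
def JetRing.coord (m : ℕ∞) (i : ℕ) (f : R) : JetRing R m :=
  JetRing.mk R m (MvPolynomial.X (i, f))

theorem JetRing.mk_eq_of_rel {m : ℕ∞} {a b : MvPolynomial (ℕ × R) ℂ} (h : JetRel R m a b) :
    JetRing.mk R m a = JetRing.mk R m b :=
  Ideal.Quotient.eq.2 (Ideal.subset_span ⟨a, b, h, rfl⟩)

theorem JetRing.coord_add (m : ℕ∞) (i : ℕ) (f g : R) :
    coord m i (f + g) = coord m i f + coord m i g := by
  exact (mk_eq_of_rel (JetRel.add (m := m) i f g)).trans (map_add _ _ _)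

theorem JetRing.coord_const (m : ℕ∞) (i : ℕ) (c : ℂ) :
    coord m i (algebraMap ℂ R c) = if i = 0 then algebraMap ℂ (JetRing R m) c else 0 := by
  refine (mk_eq_of_rel (JetRel.const (m := m) i c)).trans ?_
  split_ifs
  · exact (JetRing.mk R m).commutes c
  · exact map_zero _

theorem JetRing.coord_mul {m : ℕ∞} {i : ℕ} (hi : (i : ℕ∞) ≤ m) (f g : R) :
    coord m i (f * g) = ∑ p ∈ Finset.HasAntidiagonal.antidiagonal i, coord m p.1 f * coord m p.2 g := by
  refine (mk_eq_of_rel (JetRel.mul (m := m) i hi f g)).trans ?_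
  rw [map_sum]
  exact Finset.sum_congr rfl fun p _ => map_mul _ _ _

theorem JetRing.coord_of_lt {m : ℕ∞} {i : ℕ} (hi : m < (i : ℕ∞)) (f : R) : coord m i f = 0 := by
  exact (mk_eq_of_rel (JetRel.high (m := m) i hi f)).trans (map_zero _)

/-- The universal jet `R → R_m[t] / (t ^ (m + 1))`. -/
def JetRing.univ (R : Type u) [CommRing R] [Algebra ℂ R] (m : ℕ∞) :
    R →ₐ[ℂ] TruncSeries (JetRing R m) m where
  toFun f := TruncSeries.mk _ m (PowerSeries.mk fun i => coord m i f)
  map_one' := by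
    refine TruncSeries.ext fun i hi => ?_
    rw [← map_one (TruncSeries.mk (JetRing R m) m), TruncSeries.coeff_mk hi,
      TruncSeries.coeff_mk hi, PowerSeries.coeff_mk, PowerSeries.coeff_one,
      ← map_one (algebraMap ℂ R), coord_const, map_one]
  map_mul' f g := by
    refine TruncSeries.ext fun i hi => ?_
    rw [← map_mul, TruncSeries.coeff_mk hi, TruncSeries.coeff_mk hi, PowerSeries.coeff_mk,
      PowerSeries.coeff_mul, coord_mul hi]
    simp only [PowerSeries.coeff_mk]
  map_zero' := by
    refine TruncSeries.ext fun i hi => ?_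
    rw [TruncSeries.coeff_mk hi, PowerSeries.coeff_mk, ← map_zero (algebraMap ℂ R), coord_const,
      map_zero, map_zero, ite_self]
  map_add' f g := by
    refine TruncSeries.ext fun i hi => ?_
    rw [← map_add, TruncSeries.coeff_mk hi, TruncSeries.coeff_mk hi, map_add]
    simp only [PowerSeries.coeff_mk, coord_add]
  commutes' c := by
    refine TruncSeries.ext fun i hi => ?_
    rw [TruncSeries.coeff_mk hi, PowerSeries.coeff_mk, coord_const]
    rw [TruncSeries.coeff_algebraMap]

theorem JetRing.coeff_univ (m : ℕ∞) (i : ℕ) (f : R) :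
    TruncSeries.coeff _ m i (univ R m f) = coord m i f := by
  by_cases hi : (i : ℕ∞) ≤ m
  · exact (TruncSeries.coeff_mk hi _).trans (PowerSeries.coeff_mk _ _)
  · rw [TruncSeries.coeff_of_lt (not_le.1 hi), coord_of_lt (not_le.1 hi)]

theorem JetRing.algHom_ext {A : Type v} [CommRing A] [Algebra ℂ A] {m : ℕ∞}
    {φ ψ : JetRing R m →ₐ[ℂ] A} (h : ∀ i f, φ (coord m i f) = ψ (coord m i f)) : φ = ψ :=
  Ideal.Quotient.algHom_ext ℂ (MvPolynomial.algHom_ext fun p => h p.1 p.2)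

/-- The evaluation of functions on the jet scheme at an `A`-valued jet. -/
def JetRing.lift {A : Type v} [CommRing A] [Algebra ℂ A] (m : ℕ∞)
    (x : R →ₐ[ℂ] TruncSeries A m) : JetRing R m →ₐ[ℂ] A :=
  Ideal.Quotient.liftₐ (jetIdeal R m)
    (MvPolynomial.aeval fun p : ℕ × R => TruncSeries.coeff A m p.1 (x p.2)) (by
      intro a ha
      rw [← RingHom.mem_ker]
      revert a
      change jetIdeal R m ≤ _
      refine Ideal.span_le.2 ?_
      rintro _ ⟨a, b, hab, rfl⟩
      rw [SetLike.mem_coe, RingHom.mem_ker, map_sub, sub_eq_zero]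
      induction hab with
      | add i f g => simp
      | const i c =>
        rw [MvPolynomial.aeval_X, AlgHom.commutes, TruncSeries.coeff_algebraMap]
        split_ifs <;> simp
      | mul i hi f g => simp [TruncSeries.coeff_mul hi]
      | high i hi f => simp [TruncSeries.coeff_of_lt hi])

@[simp] theorem JetRing.lift_coord {A : Type v} [CommRing A] [Algebra ℂ A] (m : ℕ∞)
    (x : R →ₐ[ℂ] TruncSeries A m) (i : ℕ) (f : R) :
    lift m x (coord m i f) = TruncSeries.coeff A m i (x f) :=
  MvPolynomial.aeval_X _ _

/-- The universal property of the jet scheme: `A`-valued points of `Spec R_m` are the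
`A[t] / (t ^ (m + 1))`-valued points of `Spec R`. -/
def JetRing.homEquiv (R : Type u) [CommRing R] [Algebra ℂ R] (m : ℕ∞) (A : Type v) [CommRing A]
    [Algebra ℂ A] : (JetRing R m →ₐ[ℂ] A) ≃ (R →ₐ[ℂ] TruncSeries A m) where
  toFun φ := (TruncSeries.map m φ).comp (univ R m)
  invFun x := lift m x
  left_inv φ := algHom_ext fun i f => by
    rw [lift_coord, AlgHom.comp_apply, TruncSeries.coeff_map, coeff_univ]
  right_inv x := AlgHom.ext fun f => TruncSeries.ext fun i _ => by
    rw [AlgHom.comp_apply, TruncSeries.coeff_map, coeff_univ, lift_coord]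

/-- The map `J_m(R) → J_m(S)` induced by `R → S`, i.e. the morphism induced on jet schemes. -/
def JetRing.map {S : Type v} [CommRing S] [Algebra ℂ S] (m : ℕ∞) (φ : R →ₐ[ℂ] S) :
    JetRing R m →ₐ[ℂ] JetRing S m :=
  lift m ((univ S m).comp φ)

@[simp] theorem JetRing.map_coord {S : Type v} [CommRing S] [Algebra ℂ S] (m : ℕ∞)
    (φ : R →ₐ[ℂ] S) (i : ℕ) (f : R) : map m φ (coord m i f) = coord m i (φ f) := by
  rw [map, lift_coord, AlgHom.comp_apply, coeff_univ]

/-- The derivation of the polynomial ring in the coordinates of arcs given by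
`D f^{(i)} = (i + 1) f^{(i + 1)}`, where `f^{(i)}` is the `i`-th coefficient of the arc. -/
def arcDerivationAux (R : Type u) [CommRing R] [Algebra ℂ R] :
    Derivation ℂ (MvPolynomial (ℕ × R) ℂ) (MvPolynomial (ℕ × R) ℂ) :=
  MvPolynomial.mkDerivation ℂ fun p => (p.1 + 1) • MvPolynomial.X (p.1 + 1, p.2)

theorem arcDerivationAux_mem {a : MvPolynomial (ℕ × R) ℂ} (ha : a ∈ jetIdeal R ⊤) :
    arcDerivationAux R a ∈ jetIdeal R ⊤ := by
  have key : ∀ a b, JetRel R ⊤ a b → arcDerivationAux R (a - b) ∈ jetIdeal R ⊤ := by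
    intro a b hab
    rw [map_sub]
    rw [← JetRing.mk_eq_zero, map_sub, sub_eq_zero]
    induction hab with
    | add i f g =>
      simp only [arcDerivationAux, map_add, MvPolynomial.mkDerivation_X, map_nsmul]
      change (i + 1) • JetRing.coord ⊤ (i + 1) (f + g) =
        (i + 1) • JetRing.coord ⊤ (i + 1) f + (i + 1) • JetRing.coord ⊤ (i + 1) g
      rw [JetRing.coord_add, smul_add]
    | const i c =>
      have h0 : arcDerivationAux R (if i = 0 then MvPolynomial.C c else 0) = 0 := by
        split_ifs
        · exact (arcDerivationAux R).map_algebraMap c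
        · exact map_zero _
      rw [h0, map_zero, arcDerivationAux, MvPolynomial.mkDerivation_X, map_nsmul]
      change (i + 1) • JetRing.coord ⊤ (i + 1) (algebraMap ℂ R c) = 0
      rw [JetRing.coord_const, if_neg (Nat.succ_ne_zero i), smul_zero]
    | mul i hi f g =>
      have hlhs : JetRing.mk R ⊤
          (arcDerivationAux R (MvPolynomial.X (i, f * g))) =
          ((i + 1 : ℕ) : JetRing R ⊤) * JetRing.coord ⊤ (i + 1) (f * g) := by
        rw [arcDerivationAux, MvPolynomial.mkDerivation_X, map_nsmul, nsmul_eq_mul]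
        rfl
      have hX : ∀ (j : ℕ) (h : R), JetRing.mk R ⊤
          (arcDerivationAux R (MvPolynomial.X (j, h))) =
          ((j + 1 : ℕ) : JetRing R ⊤) * JetRing.coord ⊤ (j + 1) h := by
        intro j h
        rw [arcDerivationAux, MvPolynomial.mkDerivation_X, map_nsmul, nsmul_eq_mul]
        rfl
      have hc : ∀ (j : ℕ) (h : R), JetRing.mk R ⊤
          (MvPolynomial.X (j, h)) = JetRing.coord ⊤ j h := fun _ _ => rfl
      rw [hlhs, JetRing.coord_mul le_top, Finset.mul_sum]
      simp only [map_sum, Derivation.leibniz, smul_eq_mul, map_add, map_mul, hX, hc]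
      rw [Finset.sum_add_distrib]
      have hsplit : ∀ p ∈ Finset.HasAntidiagonal.antidiagonal (i + 1),
          ((i + 1 : ℕ) : JetRing R ⊤) * (JetRing.coord ⊤ p.1 f * JetRing.coord ⊤ p.2 g) =
          (p.2 : JetRing R ⊤) * (JetRing.coord ⊤ p.1 f * JetRing.coord ⊤ p.2 g) +
          (p.1 : JetRing R ⊤) * (JetRing.coord ⊤ p.1 f * JetRing.coord ⊤ p.2 g) := by
        intro p hp
        rw [← Finset.HasAntidiagonal.mem_antidiagonal.1 hp]
        push_cast
        ring
      rw [Finset.sum_congr rfl hsplit, Finset.sum_add_distrib,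
        Finset.Nat.sum_antidiagonal_succ', Finset.Nat.sum_antidiagonal_succ]
      simp only [Nat.cast_zero, zero_mul, zero_add]
      congr 1 <;> exact Finset.sum_congr rfl fun p _ => by ring
    | high i hi f => exact absurd hi (not_lt.2 le_top)
  refine Submodule.span_induction ?_ ?_ ?_ ?_ ha
  · rintro _ ⟨a, b, hab, rfl⟩
    exact key a b hab
  · rw [map_zero]; exact zero_mem _
  · intro x y _ _ hx hy
    rw [map_add]; exact add_mem hx hy
  · intro c x hx hdx
    rw [smul_eq_mul, Derivation.leibniz, smul_eq_mul, smul_eq_mul]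
    exact add_mem (Ideal.mul_mem_left _ _ hdx) (Ideal.mul_mem_right _ _ hx)

/-- The canonical derivation `D` of the coordinate ring of the arc space. -/
def arcDerivation (R : Type u) [CommRing R] [Algebra ℂ R] :
    Derivation ℂ (JetRing R ⊤) (JetRing R ⊤) :=
  Derivation.liftOfSurjective (f := JetRing.mk R ⊤)
    (JetRing.mk_surjective R ⊤) (d := arcDerivationAux R) (by
      intro x hx
      exact (JetRing.mk_eq_zero R).2 (arcDerivationAux_mem ((JetRing.mk_eq_zero R).1 hx)))

end Jets

section Actions

/-- The canonical map `O((Y × X)_m) → O(Y_m) ⊗ O(X_m)`, dual to the morphism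
`Y_m × X_m → (Y × X)_m` which pairs a jet in `Y = Spec H` with a jet in `X = Spec R`. -/
def jetProd (H : Type u) [CommRing H] [Algebra ℂ H] (R : Type v) [CommRing R] [Algebra ℂ R]
    (m : ℕ∞) : JetRing (H ⊗[ℂ] R) m →ₐ[ℂ] JetRing H m ⊗[ℂ] JetRing R m :=
  JetRing.lift (A := JetRing H m ⊗[ℂ] JetRing R m) m (Algebra.TensorProduct.productMap
    ((TruncSeries.map (A := JetRing H m) (B := JetRing H m ⊗[ℂ] JetRing R m) m
      Algebra.TensorProduct.includeLeft).comp (JetRing.univ H m))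
    ((TruncSeries.map (A := JetRing R m) (B := JetRing H m ⊗[ℂ] JetRing R m) m
      Algebra.TensorProduct.includeRight).comp (JetRing.univ R m)))

variable (H : Type u) [CommRing H] [HopfAlgebra ℂ H]

/-- An action of the affine algebraic group `G = Spec H` on the affine scheme `X = Spec R`.
The algebra map `coact` sends a function `f` on `X` to the function `(g, x) ↦ f (g x)` on
`G × X`. -/
structure AffineAction (R : Type v) [CommRing R] [Algebra ℂ R] where
  coact : R →ₐ[ℂ] H ⊗[ℂ] R
  coassoc : ((Algebra.TensorProduct.assoc ℂ ℂ ℂ H H R).toAlgHom.comp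
      (Algebra.TensorProduct.map (Bialgebra.comulAlgHom ℂ H) (AlgHom.id ℂ R))).comp coact =
    (Algebra.TensorProduct.map (AlgHom.id ℂ H) coact).comp coact
  counit : ((Algebra.TensorProduct.lid ℂ R).toAlgHom.comp
      (Algebra.TensorProduct.map (Bialgebra.counitAlgHom ℂ H) (AlgHom.id ℂ R))).comp coact =
    AlgHom.id ℂ R

variable {H} {R : Type v} [CommRing R] [Algebra ℂ R]

namespace AffineAction

/-- `G`-equivariance of the morphism `Spec S → Spec R` given by `φ : R → S`. -/
def IsEquivariant {S : Type w} [CommRing S] [Algebra ℂ S] (σ : AffineAction H R)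
    (τ : AffineAction H S) (φ : R →ₐ[ℂ] S) : Prop :=
  τ.coact.comp φ = (Algebra.TensorProduct.map (AlgHom.id ℂ H) φ).comp σ.coact

/-- The ring of invariants `O(X)^G`, the coordinate ring of the quotient `X // G`. -/
def invariants (σ : AffineAction H R) : Subalgebra ℂ R :=
  AlgHom.equalizer σ.coact Algebra.TensorProduct.includeRight

/-- The quotient map `p : X → X // G` on points. -/
def quotientMap (σ : AffineAction H R) : PrimeSpectrum R → PrimeSpectrum σ.invariants :=
  PrimeSpectrum.comap (algebraMap σ.invariants R)

/-- A subset `S` of `X` is `G`-saturated if `S = p⁻¹(p(S))`. -/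
def IsSaturated (σ : AffineAction H R) (S : Set (PrimeSpectrum R)) : Prop :=
  S = σ.quotientMap ⁻¹' (σ.quotientMap '' S)

/-- `τ` is, via `φ`, (isomorphic to) a Zariski open `G`-saturated affine subset of `σ`:
the equivariant morphism `Spec S → Spec R` is an open immersion with `G`-saturated image. -/
structure IsSaturatedOpen {S : Type v} [CommRing S] [Algebra ℂ S] (σ : AffineAction H R)
    (τ : AffineAction H S) (φ : R →ₐ[ℂ] S) : Prop where
  equivariant : σ.IsEquivariant τ φ
  isOpenImmersion :
    AlgebraicGeometry.IsOpenImmersion (AlgebraicGeometry.Spec.map (CommRingCat.ofHom φ.toRingHom))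
  saturated : σ.IsSaturated (Set.range (PrimeSpectrum.comap φ.toRingHom))

/-- The action of `G_m` on `X_m`: the composition of `G_m × X_m → (G × X)_m` with the morphism
`(G × X)_m → X_m` induced by the action of `G` on `X`. -/
def jetCoact (σ : AffineAction H R) (m : ℕ∞) :
    JetRing R m →ₐ[ℂ] JetRing H m ⊗[ℂ] JetRing R m :=
  (jetProd H R m).comp (JetRing.map m σ.coact)

/-- The ring of invariants `O(X_m)^{G_m}`. -/
def jetInvariants (σ : AffineAction H R) (m : ℕ∞) : Subalgebra ℂ (JetRing R m) :=
  AlgHom.equalizer (σ.jetCoact m) Algebra.TensorProduct.includeRight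

theorem map_val_mem_jetInvariants (σ : AffineAction H R) (m : ℕ∞)
    (a : JetRing σ.invariants m) :
    JetRing.map m σ.invariants.val a ∈ σ.jetInvariants m := by
  have h : (σ.jetCoact m).comp (JetRing.map m σ.invariants.val) =
      (Algebra.TensorProduct.includeRight :
        JetRing R m →ₐ[ℂ] JetRing H m ⊗[ℂ] JetRing R m).comp (JetRing.map m σ.invariants.val) := by
    refine JetRing.algHom_ext fun i f => ?_
    have hf : σ.coact (f : R) = 1 ⊗ₜ[ℂ] (f : R) := f.2
    rw [AlgHom.comp_apply, AlgHom.comp_apply, JetRing.map_coord, Subalgebra.coe_val, jetCoact,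
      AlgHom.comp_apply, JetRing.map_coord, hf, jetProd, JetRing.lift_coord,
      Algebra.TensorProduct.productMap_apply_tmul, map_one, one_mul, AlgHom.comp_apply,
      TruncSeries.coeff_map, JetRing.coeff_univ]
  exact DFunLike.congr_fun h a

/-- The homomorphism `p_m^* : O((X // G)_m) → O(X_m)^{G_m}` induced by `p : X → X // G`. -/
def pStar (σ : AffineAction H R) (m : ℕ∞) :
    JetRing σ.invariants m →ₐ[ℂ] σ.jetInvariants m :=
  (JetRing.map m σ.invariants.val).codRestrict _ (σ.map_val_mem_jetInvariants m)

/-- `X` is `m`-very good if `p_m^*` is an isomorphism. -/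
def IsVeryGood (σ : AffineAction H R) (m : ℕ∞) : Prop := Function.Bijective (σ.pStar m)

/-- `X` is `m`-good if `p_m^*` is surjective. -/
def IsGood (σ : AffineAction H R) (m : ℕ∞) : Prop := Function.Surjective (σ.pStar m)

/-- `X` is `D`-finite if `O(X_∞)^{G_∞}` is finitely generated as a differential algebra: for some
finite set `S`, it is the subalgebra generated by the `D^n s`, `s ∈ S`, `n ≥ 0`. -/
def IsDFinite (σ : AffineAction H R) : Prop :=
  ∃ S : Set (JetRing R ⊤), S.Finite ∧
    σ.jetInvariants ⊤ = Algebra.adjoin ℂ {b | ∃ s ∈ S, ∃ n : ℕ, b = (arcDerivation R)^[n] s}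

theorem isUnit_coact (σ : AffineAction H R) {f : R} (hf : f ∈ σ.invariants)
    (y : Submonoid.powers f) : IsUnit (((Algebra.TensorProduct.map (AlgHom.id ℂ H)
      (IsScalarTower.toAlgHom ℂ R (Localization.Away f))).comp σ.coact) y) := by
  obtain ⟨_, n, rfl⟩ := y
  have h : σ.coact f = 1 ⊗ₜ[ℂ] f := hf
  change IsUnit (((Algebra.TensorProduct.map (AlgHom.id ℂ H)
      (IsScalarTower.toAlgHom ℂ R (Localization.Away f))).comp σ.coact) (f ^ n))
  rw [map_pow]
  refine IsUnit.pow n ?_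
  rw [AlgHom.comp_apply, h, Algebra.TensorProduct.map_tmul, map_one]
  exact (IsLocalization.Away.algebraMap_isUnit f).map
    (Algebra.TensorProduct.includeRight : Localization.Away f →ₐ[ℂ] H ⊗[ℂ] Localization.Away f)

/-- The action on the principal open subset `X_f`, `f` an invariant. -/
def localizeAway (σ : AffineAction H R) (f : R) (hf : f ∈ σ.invariants) :
    AffineAction H (Localization.Away f) where
  coact := IsLocalization.liftAlgHom (M := Submonoid.powers f) (σ.isUnit_coact hf)
  coassoc := by
    refine IsLocalization.algHom_ext (Submonoid.powers f) (AlgHom.ext fun r => ?_)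
    have hr : ∀ r : R, IsLocalization.liftAlgHom (M := Submonoid.powers f) (σ.isUnit_coact hf)
        (algebraMap R (Localization.Away f) r) = Algebra.TensorProduct.map (AlgHom.id ℂ H)
          (IsScalarTower.toAlgHom ℂ R (Localization.Away f)) (σ.coact r) :=
      fun r => IsLocalization.lift_eq (σ.isUnit_coact hf) r
    have h1 : ∀ z : H ⊗[ℂ] R, Algebra.TensorProduct.assoc ℂ ℂ ℂ H H (Localization.Away f)
        (Algebra.TensorProduct.map (Bialgebra.comulAlgHom ℂ H) (AlgHom.id ℂ _)
          (Algebra.TensorProduct.map (AlgHom.id ℂ H)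
            (IsScalarTower.toAlgHom ℂ R (Localization.Away f)) z)) =
        Algebra.TensorProduct.map (AlgHom.id ℂ H) (Algebra.TensorProduct.map (AlgHom.id ℂ H)
            (IsScalarTower.toAlgHom ℂ R (Localization.Away f)))
          (Algebra.TensorProduct.assoc ℂ ℂ ℂ H H R
            (Algebra.TensorProduct.map (Bialgebra.comulAlgHom ℂ H) (AlgHom.id ℂ R) z)) := by
      intro z
      induction z with
      | zero => simp only [map_zero]
      | add x y hx hy => simp only [map_add, hx, hy]
      | tmul h x =>
        simp only [Algebra.TensorProduct.map_tmul, AlgHom.id_apply, Bialgebra.comulAlgHom_apply]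
        induction Coalgebra.comul (R := ℂ) h with
        | zero => simp only [TensorProduct.zero_tmul, map_zero]
        | add a b ha hb => simp only [TensorProduct.add_tmul, map_add, ha, hb]
        | tmul a b => rfl
    have h2 : ∀ z : H ⊗[ℂ] R, Algebra.TensorProduct.map (AlgHom.id ℂ H)
          (IsLocalization.liftAlgHom (M := Submonoid.powers f) (σ.isUnit_coact hf))
          (Algebra.TensorProduct.map (AlgHom.id ℂ H)
            (IsScalarTower.toAlgHom ℂ R (Localization.Away f)) z) =
        Algebra.TensorProduct.map (AlgHom.id ℂ H) (Algebra.TensorProduct.map (AlgHom.id ℂ H)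
            (IsScalarTower.toAlgHom ℂ R (Localization.Away f)))
          (Algebra.TensorProduct.map (AlgHom.id ℂ H) σ.coact z) := by
      intro z
      induction z with
      | zero => simp only [map_zero]
      | add x y hx hy => simp only [map_add, hx, hy]
      | tmul h x =>
        simp only [Algebra.TensorProduct.map_tmul, AlgHom.id_apply]
        exact congrArg _ (hr x)
    have e1 := congrArg (fun z => Algebra.TensorProduct.assoc ℂ ℂ ℂ H H (Localization.Away f)
        (Algebra.TensorProduct.map (Bialgebra.comulAlgHom ℂ H) (AlgHom.id ℂ _) z)) (hr r)
    have e2 := congrArg (Algebra.TensorProduct.map (AlgHom.id ℂ H)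
      (Algebra.TensorProduct.map (AlgHom.id ℂ H)
        (IsScalarTower.toAlgHom ℂ R (Localization.Away f))))
      (DFunLike.congr_fun σ.coassoc r)
    have e3 := congrArg (Algebra.TensorProduct.map (AlgHom.id ℂ H)
      (IsLocalization.liftAlgHom (M := Submonoid.powers f) (σ.isUnit_coact hf))) (hr r).symm
    exact (e1.trans (h1 _)).trans (e2.trans ((h2 _).symm.trans e3))
  counit := by
    refine IsLocalization.algHom_ext (Submonoid.powers f) (AlgHom.ext fun r => ?_)
    have hr : IsLocalization.liftAlgHom (M := Submonoid.powers f) (σ.isUnit_coact hf)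
        (algebraMap R (Localization.Away f) r) = Algebra.TensorProduct.map (AlgHom.id ℂ H)
          (IsScalarTower.toAlgHom ℂ R (Localization.Away f)) (σ.coact r) :=
      IsLocalization.lift_eq (σ.isUnit_coact hf) r
    have h1 : ∀ z : H ⊗[ℂ] R, Algebra.TensorProduct.lid ℂ (Localization.Away f)
        (Algebra.TensorProduct.map (Bialgebra.counitAlgHom ℂ H) (AlgHom.id ℂ _)
          (Algebra.TensorProduct.map (AlgHom.id ℂ H)
            (IsScalarTower.toAlgHom ℂ R (Localization.Away f)) z)) =
        IsScalarTower.toAlgHom ℂ R (Localization.Away f)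
          (Algebra.TensorProduct.lid ℂ R
            (Algebra.TensorProduct.map (Bialgebra.counitAlgHom ℂ H) (AlgHom.id ℂ R) z)) := by
      intro z
      induction z with
      | zero => simp only [map_zero]
      | add x y hx hy => simp only [map_add, hx, hy]
      | tmul h x =>
        simp only [Algebra.TensorProduct.map_tmul, AlgHom.id_apply,
          Algebra.TensorProduct.lid_tmul, map_smul]
    have e1 := congrArg (fun z => Algebra.TensorProduct.lid ℂ (Localization.Away f)
      (Algebra.TensorProduct.map (Bialgebra.counitAlgHom ℂ H) (AlgHom.id ℂ _) z)) hr
    have e2 := congrArg (IsScalarTower.toAlgHom ℂ R (Localization.Away f))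
      (DFunLike.congr_fun σ.counit r)
    exact (e1.trans (h1 _)).trans e2

end AffineAction

variable (H)

/-- A rational representation of `G = Spec H` on the vector space `W`. The linear map `coact` sends
`w` to the `W`-valued function `g ↦ g w` on `G`. -/
structure Rep (W : Type v) [AddCommGroup W] [Module ℂ W] where
  coact : W →ₗ[ℂ] W ⊗[ℂ] H
  coassoc : (TensorProduct.assoc ℂ W H H).toLinearMap ∘ₗ coact.rTensor H ∘ₗ coact =
    (Coalgebra.comul (R := ℂ) (A := H)).lTensor W ∘ₗ coact
  counit : (TensorProduct.rid ℂ W).toLinearMap ∘ₗ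
    (Coalgebra.counit (R := ℂ) (A := H)).lTensor W ∘ₗ coact = LinearMap.id

variable {H}

/-- `G`-stability of a linear subspace. -/
def Rep.IsStable {W : Type v} [AddCommGroup W] [Module ℂ W] (ρ : Rep H W)
    (N : Submodule ℂ W) : Prop :=
  ∀ w ∈ N, ρ.coact w ∈ LinearMap.range (N.subtype.rTensor H)

variable (H) in
/-- The linear algebraic group `G = Spec H` is reductive: every finite dimensional rational
representation is completely reducible. (Over `ℂ` this is equivalent to the triviality of the
unipotent radical.) -/
def IsReductive : Prop :=
  ∀ (W : Type) [AddCommGroup W] [Module ℂ W] [FiniteDimensional ℂ W] (ρ : Rep H W)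
    (N : Submodule ℂ W), ρ.IsStable N → ∃ N' : Submodule ℂ W, ρ.IsStable N' ∧ IsCompl N N'

/-- The coordinate ring `O(W)` of a finite dimensional vector space `W`. -/
abbrev PolyFun (W : Type v) [AddCommGroup W] [Module ℂ W] : Type v :=
  SymmetricAlgebra ℂ (Module.Dual ℂ W)

/-- The value of a polynomial function at a point. -/
def PolyFun.eval {W : Type v} [AddCommGroup W] [Module ℂ W] (w : W) : PolyFun W →ₐ[ℂ] ℂ :=
  SymmetricAlgebra.lift (Module.Dual.eval ℂ W w)

namespace Rep

variable {W : Type v} [AddCommGroup W] [Module ℂ W]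

theorem tensor_eq_sum {ι : Type*} [Fintype ι] (b : Module.Basis ι ℂ W) {M : Type*}
    [AddCommGroup M] [Module ℂ M] (z : W ⊗[ℂ] M) :
    z = ∑ k, b k ⊗ₜ[ℂ] TensorProduct.lid ℂ M ((b.coord k).rTensor M z) := by
  induction z with
  | zero => simp
  | add x y hx hy =>
    simp only [map_add, TensorProduct.tmul_add, Finset.sum_add_distrib]
    rw [← hx, ← hy]
  | tmul w x =>
    simp only [LinearMap.rTensor_tmul, TensorProduct.lid_tmul, ← TensorProduct.smul_tmul,
      ← TensorProduct.sum_tmul, Module.Basis.coord_apply, b.sum_repr]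

theorem coord_sum {ι : Type*} [Fintype ι] (b : Module.Basis ι ℂ W) {M : Type*}
    [AddCommGroup M] [Module ℂ M] (x : ι → M) (i : ι) :
    TensorProduct.lid ℂ M ((b.coord i).rTensor M (∑ k, b k ⊗ₜ[ℂ] x k)) = x i := by
  classical
  simp [Finsupp.single_apply]

variable [FiniteDimensional ℂ W]

/-- For a linear form `ξ` on `W`, the function `(g, w) ↦ ξ (g w)` on `G × W`, as an element of
`H ⊗ W*`. -/
def dualCoact (ρ : Rep H W) : Module.Dual ℂ W →ₗ[ℂ] H ⊗[ℂ] Module.Dual ℂ W :=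
  (TensorProduct.comm ℂ (Module.Dual ℂ W) H).toLinearMap ∘ₗ
    (dualTensorHomEquiv ℂ W H).symm.toLinearMap ∘ₗ
    (LinearMap.lcomp ℂ H ρ.coact) ∘ₗ
    (LinearMap.compRight ℂ (TensorProduct.lid ℂ H).toLinearMap) ∘ₗ
    (LinearMap.rTensorHom H : Module.Dual ℂ W →ₗ[ℂ] (W ⊗[ℂ] H →ₗ[ℂ] ℂ ⊗[ℂ] H))

theorem dualCoact_eq_sum {ι : Type*} [Fintype ι] (b : Module.Basis ι ℂ W) (ρ : Rep H W)
    (ξ : Module.Dual ℂ W) : ρ.dualCoact ξ =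
      ∑ j, TensorProduct.lid ℂ H (ξ.rTensor H (ρ.coact (b j))) ⊗ₜ[ℂ] b.coord j := by
  have h : (dualTensorHomEquiv ℂ W H).symm
      ((TensorProduct.lid ℂ H).toLinearMap ∘ₗ ξ.rTensor H ∘ₗ ρ.coact) =
      ∑ j, b.coord j ⊗ₜ[ℂ] TensorProduct.lid ℂ H (ξ.rTensor H (ρ.coact (b j))) := by
    rw [LinearEquiv.symm_apply_eq]
    refine b.ext fun i => ?_
    classical
    rw [map_sum, LinearMap.sum_apply]
    change _ = ∑ j, dualTensorHom ℂ W H (_ ⊗ₜ _) (b i)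
    simp [Finsupp.single_apply]
  change TensorProduct.comm ℂ (Module.Dual ℂ W) H ((dualTensorHomEquiv ℂ W H).symm
      ((TensorProduct.lid ℂ H).toLinearMap ∘ₗ ξ.rTensor H ∘ₗ ρ.coact)) = _
  rw [h, map_sum]
  rfl

theorem dualCoact_coassoc (ρ : Rep H W) (ξ : Module.Dual ℂ W) :
    TensorProduct.assoc ℂ H H _
      ((Coalgebra.comul (R := ℂ) (A := H)).rTensor (Module.Dual ℂ W) (ρ.dualCoact ξ)) =
    ρ.dualCoact.lTensor H (ρ.dualCoact ξ) := by
  let b := Module.finBasis ℂ W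
  let a : Fin _ → Fin _ → H := fun i j =>
    TensorProduct.lid ℂ H ((b.coord i).rTensor H (ρ.coact (b j)))
  have hρ : ∀ j, ρ.coact (b j) = ∑ k, b k ⊗ₜ[ℂ] a k j := fun j => tensor_eq_sum b _
  have hσ : ∀ i, ρ.dualCoact (b.coord i) = ∑ j, a i j ⊗ₜ[ℂ] b.coord j :=
    fun i => dualCoact_eq_sum b ρ _
  have hΔ : ∀ i j, Coalgebra.comul (R := ℂ) (a i j) = ∑ k, a i k ⊗ₜ[ℂ] a k j := by
    intro i j
    have h := LinearMap.congr_fun ρ.coassoc (b j)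
    simp only [LinearMap.comp_apply, hρ, map_sum, LinearMap.rTensor_tmul, LinearMap.lTensor_tmul,
      LinearEquiv.coe_coe, TensorProduct.sum_tmul, TensorProduct.assoc_tmul] at h
    rw [Finset.sum_comm] at h
    simp only [← TensorProduct.tmul_sum] at h
    have h' := congrArg (fun z => TensorProduct.lid ℂ _ ((b.coord i).rTensor (H ⊗[ℂ] H) z)) h
    simp only [coord_sum] at h'
    exact h'.symm
  have key : (TensorProduct.assoc ℂ H H (Module.Dual ℂ W)).toLinearMap ∘ₗ
      (Coalgebra.comul (R := ℂ) (A := H)).rTensor (Module.Dual ℂ W) ∘ₗ ρ.dualCoact =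
      ρ.dualCoact.lTensor H ∘ₗ ρ.dualCoact := by
    refine b.dualBasis.ext fun i => ?_
    have hb : b.dualBasis i = b.coord i := by simp
    simp only [LinearMap.comp_apply, hb, hσ, map_sum, LinearMap.rTensor_tmul,
      LinearMap.lTensor_tmul, LinearEquiv.coe_coe, hΔ, TensorProduct.sum_tmul,
      TensorProduct.assoc_tmul, TensorProduct.tmul_sum]
    rw [Finset.sum_comm]
  exact LinearMap.congr_fun key ξ

theorem dualCoact_counit (ρ : Rep H W) (ξ : Module.Dual ℂ W) :
    TensorProduct.lid ℂ _
      ((Coalgebra.counit (R := ℂ) (A := H)).rTensor (Module.Dual ℂ W) (ρ.dualCoact ξ)) = ξ := by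
  let b := Module.finBasis ℂ W
  refine b.ext fun j => ?_
  rw [dualCoact_eq_sum b, map_sum, map_sum, LinearMap.sum_apply]
  have h := congrArg ξ (LinearMap.congr_fun ρ.counit (b j))
  rw [LinearMap.id_apply] at h
  rw [← h]
  have h2 : ∀ z : W ⊗[ℂ] H, ξ (TensorProduct.rid ℂ W
      ((Coalgebra.counit (R := ℂ) (A := H)).lTensor W z)) =
      Coalgebra.counit (R := ℂ) (TensorProduct.lid ℂ H (ξ.rTensor H z)) := by
    intro z
    induction z with
    | zero => simp
    | add x y hx hy => simp only [map_add, hx, hy]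
    | tmul w x => simp [mul_comm]
  classical
  simp only [LinearMap.comp_apply, LinearEquiv.coe_coe, h2]
  simp [Finsupp.single_apply]

/-- The affine `G`-variety underlying a `G`-module: a polynomial function `F` on `W` is sent
to `(g, w) ↦ F (g w)`. -/
def toAffineAction (ρ : Rep H W) : AffineAction H (PolyFun W) where
  coact := SymmetricAlgebra.lift
    ((SymmetricAlgebra.ι ℂ (Module.Dual ℂ W)).lTensor H ∘ₗ ρ.dualCoact)
  coassoc := by
    refine SymmetricAlgebra.algHom_ext (LinearMap.ext fun ξ => ?_)
    have hL : ∀ η : Module.Dual ℂ W, SymmetricAlgebra.lift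
        ((SymmetricAlgebra.ι ℂ (Module.Dual ℂ W)).lTensor H ∘ₗ ρ.dualCoact)
        (SymmetricAlgebra.ι ℂ _ η) =
        (SymmetricAlgebra.ι ℂ (Module.Dual ℂ W)).lTensor H (ρ.dualCoact η) :=
      fun η => SymmetricAlgebra.lift_ι_apply _ η
    have h1 : ∀ z : H ⊗[ℂ] Module.Dual ℂ W,
        Algebra.TensorProduct.assoc ℂ ℂ ℂ H H (PolyFun W)
          (Algebra.TensorProduct.map (Bialgebra.comulAlgHom ℂ H) (AlgHom.id ℂ _)
            ((SymmetricAlgebra.ι ℂ (Module.Dual ℂ W)).lTensor H z)) =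
        ((SymmetricAlgebra.ι ℂ (Module.Dual ℂ W)).lTensor H).lTensor H
          (TensorProduct.assoc ℂ H H _
            ((Coalgebra.comul (R := ℂ) (A := H)).rTensor (Module.Dual ℂ W) z)) := by
      intro z
      induction z with
      | zero => simp only [map_zero]
      | add x y hx hy => simp only [map_add, hx, hy]
      | tmul h x =>
        simp only [LinearMap.lTensor_tmul, LinearMap.rTensor_tmul, Algebra.TensorProduct.map_tmul,
          AlgHom.id_apply, Bialgebra.comulAlgHom_apply]
        induction Coalgebra.comul (R := ℂ) h with
        | zero => simp only [TensorProduct.zero_tmul, map_zero]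
        | add a b ha hb => simp only [TensorProduct.add_tmul, map_add, ha, hb]
        | tmul a b => rfl
    have h2 : ∀ z : H ⊗[ℂ] Module.Dual ℂ W,
        Algebra.TensorProduct.map (AlgHom.id ℂ H) (SymmetricAlgebra.lift
          ((SymmetricAlgebra.ι ℂ (Module.Dual ℂ W)).lTensor H ∘ₗ ρ.dualCoact))
          ((SymmetricAlgebra.ι ℂ (Module.Dual ℂ W)).lTensor H z) =
        ((SymmetricAlgebra.ι ℂ (Module.Dual ℂ W)).lTensor H).lTensor H
          (ρ.dualCoact.lTensor H z) := by
      intro z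
      induction z with
      | zero => simp only [map_zero]
      | add x y hx hy => simp only [map_add, hx, hy]
      | tmul h x =>
        simp only [LinearMap.lTensor_tmul, Algebra.TensorProduct.map_tmul, AlgHom.id_apply]
        exact congrArg _ (hL x)
    have e1 := congrArg (fun z => Algebra.TensorProduct.assoc ℂ ℂ ℂ H H (PolyFun W)
      (Algebra.TensorProduct.map (Bialgebra.comulAlgHom ℂ H) (AlgHom.id ℂ _) z)) (hL ξ)
    have e2 := congrArg (((SymmetricAlgebra.ι ℂ (Module.Dual ℂ W)).lTensor H).lTensor H)
      (ρ.dualCoact_coassoc ξ)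
    have e3 := congrArg (Algebra.TensorProduct.map (AlgHom.id ℂ H) (SymmetricAlgebra.lift
      ((SymmetricAlgebra.ι ℂ (Module.Dual ℂ W)).lTensor H ∘ₗ ρ.dualCoact))) (hL ξ).symm
    exact (e1.trans (h1 _)).trans (e2.trans ((h2 _).symm.trans e3))
  counit := by
    refine SymmetricAlgebra.algHom_ext (LinearMap.ext fun ξ => ?_)
    have hL : SymmetricAlgebra.lift
        ((SymmetricAlgebra.ι ℂ (Module.Dual ℂ W)).lTensor H ∘ₗ ρ.dualCoact)
        (SymmetricAlgebra.ι ℂ _ ξ) =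
        (SymmetricAlgebra.ι ℂ (Module.Dual ℂ W)).lTensor H (ρ.dualCoact ξ) :=
      SymmetricAlgebra.lift_ι_apply _ ξ
    have h1 : ∀ z : H ⊗[ℂ] Module.Dual ℂ W,
        Algebra.TensorProduct.lid ℂ (PolyFun W)
          (Algebra.TensorProduct.map (Bialgebra.counitAlgHom ℂ H) (AlgHom.id ℂ _)
            ((SymmetricAlgebra.ι ℂ (Module.Dual ℂ W)).lTensor H z)) =
        SymmetricAlgebra.ι ℂ (Module.Dual ℂ W) (TensorProduct.lid ℂ _
          ((Coalgebra.counit (R := ℂ) (A := H)).rTensor (Module.Dual ℂ W) z)) := by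
      intro z
      induction z with
      | zero => simp only [map_zero]
      | add x y hx hy => simp only [map_add, hx, hy]
      | tmul h x =>
        simp only [LinearMap.lTensor_tmul, LinearMap.rTensor_tmul, Algebra.TensorProduct.map_tmul,
          AlgHom.id_apply, Algebra.TensorProduct.lid_tmul, TensorProduct.lid_tmul, map_smul]
        rfl
    have e1 := congrArg (fun z => Algebra.TensorProduct.lid ℂ (PolyFun W)
      (Algebra.TensorProduct.map (Bialgebra.counitAlgHom ℂ H) (AlgHom.id ℂ _) z)) hL
    have e2 := congrArg (SymmetricAlgebra.ι ℂ (Module.Dual ℂ W)) (ρ.dualCoact_counit ξ)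
    exact (e1.trans (h1 _)).trans e2

end Rep

end Actions

end JetInvariant

end

/-! All three properties are local on the quotient `X // G`. For an invariant `f`, jets of the
principal open subset `X_f` are the jets of `X` whose base point satisfies `f ≠ 0`, so `O((X_f)_m)`
is `O(X_m)` with the zeroth coordinate of `f` inverted (`IsAwayMap.jet`). Invariants are the
equalizer of two maps `A → M ⊗ A`. Since `M` is flat over `ℂ`, this equalizer commutes with
inverting an invariant (`IsAwayMap.equalizer`). Hence `p_m^*` for `X_f` is a localization of `p_m^*`
for `X`. Bijectivity and surjectivity therefore pass to `X_f`, and can be tested on invariants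
generating the unit ideal of `O(X)^G`. For D-finiteness, the quotient rule controls derivatives of
fractions, and finitely many local generating sets are glued by a partition of unity
(`diffFinite_fractions`, `diffFinite_of_cover`).

Reductivity enters through Reynolds operators (`exists_reynolds`). Complete reducibility gives a
linear form on `O(G)` that is translation invariant on any prescribed finite set, and integrating
along the action projects onto invariants. Two consequences are needed: invariants generating the
unit ideal of `O(X)` already generate that of `O(X)^G` (`span_invariants_eq_top`), and a saturated
open set is a union of sets `X_f` with `f` invariant (`exists_invariant_of_mem`).

For (1), each `X_f` contained in `X_α` is a principal open subset of both `X` and `X_α`. These sets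
cover each `X_α`, and together they cover `X`, so each side of the equivalence can be tested on
them.

For (2), scalar multiplication by `c ≠ 0` is an equivariant automorphism of `W` and identifies `W_f`
with the locus `f(cw) ≠ 0`. These loci cover `W`: as a polynomial in `c`, `f(cw)` has the nonzero
constant term `f(0)`, so it cannot vanish for all `c ≠ 0`. -/

noncomputable section

namespace JetInvariant

universe u v

/-! ### Localization away from an element, and its compatibility with equalizers -/

/-- `ψ : A → B` exhibits `B` as the localization of `A` away from `f`. -/
structure IsAwayMap {A B : Type*} [CommRing A] [CommRing B] [Algebra ℂ A] [Algebra ℂ B]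
    (ψ : A →ₐ[ℂ] B) (f : A) : Prop where
  isUnit : IsUnit (ψ f)
  surj : ∀ y, ∃ (n : ℕ) (a : A), ψ f ^ n * y = ψ a
  ker : ∀ x, ψ x = 0 → ∃ n : ℕ, f ^ n * x = 0

/-- By flatness of `M` over `ℂ`, the kernel of `M ⊗ ψ` is the image of `M ⊗ ker ψ`, and an element
of it involves only finitely many elements of `ker ψ`, so a single power of `f` suffices. -/
theorem exists_mem_tensorProduct_pow_mul_eq_zero {M A B : Type*} [CommRing M] [CommRing A]
    [CommRing B] [Algebra ℂ M] [Algebra ℂ A] [Algebra ℂ B] {ψ : A →ₐ[ℂ] B} {f : A}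
    (hψ : ∀ x, ψ x = 0 → ∃ n : ℕ, f ^ n * x = 0) (z : M ⊗[ℂ] A)
    (hz : Algebra.TensorProduct.map (AlgHom.id ℂ M) ψ z = 0) :
    ∃ n : ℕ, (1 ⊗ₜ[ℂ] f : M ⊗[ℂ] A) ^ n * z = 0 := by
  have hz' : z ∈ LinearMap.ker (ψ.toLinearMap.lTensor M) := hz
  obtain ⟨w, rfl⟩ := (Module.Flat.lTensor_exact M
    (LinearMap.exact_subtype_ker_map ψ.toLinearMap) z).1 hz'
  clear hz hz'
  induction w with
  | zero => exact ⟨0, by simp⟩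
  | add x y hx hy =>
    obtain ⟨n, hn⟩ := hx
    obtain ⟨k, hk⟩ := hy
    refine ⟨n + k, ?_⟩
    rw [map_add, mul_add, pow_add, mul_right_comm, hn, zero_mul, zero_add, mul_assoc, hk, mul_zero]
  | tmul m x =>
    obtain ⟨n, hn⟩ := hψ x x.2
    refine ⟨n, ?_⟩
    rw [LinearMap.lTensor_tmul, Submodule.subtype_apply, Algebra.TensorProduct.tmul_pow,
      Algebra.TensorProduct.tmul_mul_tmul, hn, TensorProduct.tmul_zero]

namespace IsAwayMap

variable {A B : Type*} [CommRing A] [CommRing B] [Algebra ℂ A] [Algebra ℂ B]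
  {ψ : A →ₐ[ℂ] B} {f : A}

theorem of_isLocalization [Algebra A B] [IsScalarTower ℂ A B] (f : A)
    [IsLocalization.Away f B] : IsAwayMap (IsScalarTower.toAlgHom ℂ A B) f where
  isUnit := IsLocalization.Away.algebraMap_isUnit f
  surj y := by
    obtain ⟨n, a, h⟩ := IsLocalization.Away.surj f y
    exact ⟨n, a, by rw [mul_comm]; exact h⟩
  ker x hx := by
    have hx' : algebraMap A B x = algebraMap A B 0 := by rw [map_zero]; exact hx
    obtain ⟨⟨_, n, rfl⟩, h⟩ := (IsLocalization.eq_iff_exists (Submonoid.powers f) B).1 hx'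
    exact ⟨n, by simpa using h⟩

theorem exists_pow_mul_eq (h : IsAwayMap ψ f) {x y : A} (hxy : ψ x = ψ y) :
    ∃ n : ℕ, f ^ n * x = f ^ n * y := by
  obtain ⟨n, hn⟩ := h.ker (x - y) (by rw [map_sub, hxy, sub_self])
  exact ⟨n, by rwa [mul_sub, sub_eq_zero] at hn⟩

theorem isLocalization (h : IsAwayMap ψ f) :
    letI := ψ.toRingHom.toAlgebra
    IsLocalization.Away f B := by
  let := ψ.toRingHom.toAlgebra
  refine (isLocalization_iff _ _).2 ⟨?_, ?_, fun {x y} hxy => ?_⟩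
  · rintro ⟨_, n, rfl⟩
    change IsUnit (ψ (f ^ n))
    rw [map_pow]
    exact h.isUnit.pow n
  · intro y
    obtain ⟨n, a, hn⟩ := h.surj y
    refine ⟨(a, ⟨f ^ n, n, rfl⟩), ?_⟩
    change y * ψ (f ^ n) = ψ a
    rw [map_pow, mul_comm, hn]
  · obtain ⟨n, hn⟩ := h.exists_pow_mul_eq hxy
    exact ⟨⟨f ^ n, n, rfl⟩, hn⟩

theorem exists_lift (h : IsAwayMap ψ f) {C : Type*} [CommRing C] [Algebra ℂ C] (g : A →ₐ[ℂ] C)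
    (hg : IsUnit (g f)) : ∃ k : B →ₐ[ℂ] C, k.comp ψ = g := by
  let := ψ.toRingHom.toAlgebra
  have := h.isLocalization
  have : IsScalarTower ℂ A B := IsScalarTower.of_algebraMap_eq fun r => (ψ.commutes r).symm
  have hu : ∀ y : Submonoid.powers f, IsUnit (g y) := by
    rintro ⟨_, n, rfl⟩
    change IsUnit (g (f ^ n))
    rw [map_pow]
    exact hg.pow n
  exact ⟨IsLocalization.liftAlgHom (M := Submonoid.powers f) hu,
    AlgHom.ext fun r => IsLocalization.lift_eq hu r⟩

theorem algHom_ext (h : IsAwayMap ψ f) {C : Type*} [CommRing C] [Algebra ℂ C]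
    {k l : B →ₐ[ℂ] C} (hkl : k.comp ψ = l.comp ψ) : k = l := by
  ext y
  obtain ⟨n, a, hn⟩ := h.surj y
  have hu : IsUnit (k (ψ f ^ n)) := (h.isUnit.pow n).map k
  refine hu.mul_left_cancel ?_
  have e : ∀ x, k (ψ x) = l (ψ x) := fun x => DFunLike.congr_fun hkl x
  rw [← map_mul, hn, e, ← hn, map_mul, map_pow, ← e, ← map_pow]

/-- The localization of an equalizer is the equalizer of the localizations. -/
theorem equalizer (h : IsAwayMap ψ f) {M : Type*} [CommRing M] [Algebra ℂ M]
    {c : A →ₐ[ℂ] M ⊗[ℂ] A} {d : B →ₐ[ℂ] M ⊗[ℂ] B}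
    (hcd : d.comp ψ = (Algebra.TensorProduct.map (AlgHom.id ℂ M) ψ).comp c)
    (hf : c f = 1 ⊗ₜ f) (y : B) :
    d y = 1 ⊗ₜ y ↔ ∃ (n : ℕ) (a : A), c a = 1 ⊗ₜ a ∧ ψ f ^ n * y = ψ a := by
  have e : ∀ x, d (ψ x) = Algebra.TensorProduct.map (AlgHom.id ℂ M) ψ (c x) :=
    fun x => DFunLike.congr_fun hcd x
  have hdf : ∀ n, d (ψ f ^ n) = 1 ⊗ₜ (ψ f ^ n) := fun n => by
    rw [map_pow, e, hf, Algebra.TensorProduct.map_tmul, map_one, Algebra.TensorProduct.tmul_pow,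
      one_pow]
  constructor
  · intro hy
    obtain ⟨n, a, hn⟩ := h.surj y
    -- The numerator `a` need not lie in the equalizer, but its defect dies in the localization. A
    -- power of `1 ⊗ f` kills the defect, and moving that power into the numerator repairs it.
    have h0 : Algebra.TensorProduct.map (AlgHom.id ℂ M) ψ (c a - 1 ⊗ₜ a) = 0 := by
      rw [map_sub, ← e, ← hn, map_mul, hy, hdf, Algebra.TensorProduct.tmul_mul_tmul,
        Algebra.TensorProduct.map_tmul, map_one, one_mul, hn, sub_self]
    obtain ⟨k, hk⟩ := exists_mem_tensorProduct_pow_mul_eq_zero h.ker _ h0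
    refine ⟨k + n, f ^ k * a, ?_, by rw [pow_add, mul_assoc, hn, map_mul, map_pow]⟩
    rw [mul_sub, sub_eq_zero] at hk
    rw [map_mul, map_pow, hf, hk, Algebra.TensorProduct.tmul_pow,
      Algebra.TensorProduct.tmul_mul_tmul, one_pow, one_mul]
  · rintro ⟨n, a, ha, hn⟩
    have hu : IsUnit (d (ψ f ^ n)) := (h.isUnit.pow n).map d
    refine hu.mul_left_cancel ?_
    rw [← map_mul, hn, e, ha, Algebra.TensorProduct.map_tmul, map_one, ← hn, hdf,
      Algebra.TensorProduct.tmul_mul_tmul, one_mul]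

theorem mem_equalizer (h : IsAwayMap ψ f) {M : Type*} [CommRing M] [Algebra ℂ M]
    {c : A →ₐ[ℂ] M ⊗[ℂ] A} {d : B →ₐ[ℂ] M ⊗[ℂ] B}
    (hcd : d.comp ψ = (Algebra.TensorProduct.map (AlgHom.id ℂ M) ψ).comp c)
    (hf : f ∈ AlgHom.equalizer c Algebra.TensorProduct.includeRight) (y : B) :
    y ∈ AlgHom.equalizer d Algebra.TensorProduct.includeRight ↔
      ∃ (n : ℕ), ∃ a ∈ AlgHom.equalizer c Algebra.TensorProduct.includeRight,
        ψ f ^ n * y = ψ a :=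
  (h.equalizer hcd hf y).trans (by simp only [AlgHom.mem_equalizer]; rfl)

/-- If `C'` consists of the fractions with numerators in `C ∋ f`, then `C'` is the localization
of `C`. -/
theorem restrict (h : IsAwayMap ψ f) {C : Subalgebra ℂ A} {C' : Subalgebra ℂ B}
    (hC : ∀ y, y ∈ C' ↔ ∃ n : ℕ, ∃ a ∈ C, ψ f ^ n * y = ψ a) (hf : f ∈ C) (g : C →ₐ[ℂ] C')
    (hg : ∀ c, (g c : B) = ψ c) : IsAwayMap g ⟨f, hf⟩ where
  isUnit := by
    obtain ⟨u, hu⟩ := h.isUnit.exists_right_inv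
    have hmem : u ∈ C' := (hC u).2 ⟨1, 1, one_mem C, by rw [pow_one, hu, map_one]⟩
    exact IsUnit.of_mul_eq_one ⟨u, hmem⟩ (Subtype.ext (by
      rw [MulMemClass.coe_mul, hg]; exact hu))
  surj y := by
    obtain ⟨n, a, ha, hn⟩ := (hC y).1 y.2
    exact ⟨n, ⟨a, ha⟩, Subtype.ext (by
      rw [MulMemClass.coe_mul, SubmonoidClass.coe_pow, hg, hg]; exact hn)⟩
  ker x hx := by
    obtain ⟨n, hn⟩ := h.ker x (by rw [← hg, hx]; rfl)
    exact ⟨n, Subtype.ext hn⟩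

end IsAwayMap

/-! ### Jets of a principal open subset -/

/-- The dual of the projection `X_m → X` to the base point of a jet: the product rule for
coefficients has a single term in degree `0`. -/
theorem JetRing.coord_zero_map {R : Type*} [CommRing R] [Algebra ℂ R] (m : ℕ∞) :
    ∃ g : R →ₐ[ℂ] JetRing R m, ∀ f, g f = JetRing.coord m 0 f :=
  ⟨AlgHom.ofLinearMap
    { toFun := JetRing.coord m 0
      map_add' := JetRing.coord_add m 0
      map_smul' := fun c f => by
        rw [Algebra.smul_def, JetRing.coord_mul zero_le]
        simp [JetRing.coord_const, Algebra.smul_def] }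
    (by
      change JetRing.coord m 0 1 = 1
      rw [← map_one (algebraMap ℂ R), JetRing.coord_const, if_pos rfl, map_one])
    (fun x y => by
      change JetRing.coord m 0 (x * y) = JetRing.coord m 0 x * JetRing.coord m 0 y
      rw [JetRing.coord_mul zero_le]
      simp), fun _ => rfl⟩

theorem TruncSeries.isUnit_of_isUnit_coeff_zero {A : Type*} [CommRing A] {m : ℕ∞}
    {x : TruncSeries A m} (hx : IsUnit (TruncSeries.coeff A m 0 x)) : IsUnit x := by
  obtain ⟨φ, rfl⟩ := TruncSeries.mk_surjective A m x
  rw [TruncSeries.coeff_mk zero_le] at hx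
  exact (PowerSeries.isUnit_iff_constantCoeff.2
    (by rwa [← PowerSeries.coeff_zero_eq_constantCoeff_apply])).map _

/-- Jets of the principal open subset `f ≠ 0` are the jets with `f ≠ 0` at the base point. -/
theorem IsAwayMap.jet {R T : Type*} [CommRing R] [CommRing T] [Algebra ℂ R] [Algebra ℂ T]
    {ψ : R →ₐ[ℂ] T} {f : R} (h : IsAwayMap ψ f) (m : ℕ∞) :
    IsAwayMap (JetRing.map m ψ) (JetRing.coord m 0 f) := by
  -- The jet ring of `T` is compared with the honest localization `L` by maps in both directions,
  -- each obtained from a universal property.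
  let L := Localization.Away (JetRing.coord m 0 f)
  let g : JetRing R m →ₐ[ℂ] L := IsScalarTower.toAlgHom ℂ _ _
  have hgL : IsAwayMap g (JetRing.coord m 0 f) := IsAwayMap.of_isLocalization _
  have hunit : IsUnit (JetRing.map m ψ (JetRing.coord m 0 f)) := by
    rw [JetRing.map_coord]
    obtain ⟨c, hc⟩ := JetRing.coord_zero_map (R := T) m
    rw [← hc]
    exact h.isUnit.map c
  -- Over `L` the universal jet sends `f` to a series with unit constant term, hence to a unit, so
  -- it extends to a jet of `T`.
  obtain ⟨x, hx⟩ := h.exists_lift ((TruncSeries.map m g).comp (JetRing.univ R m)) (by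
    refine TruncSeries.isUnit_of_isUnit_coeff_zero ?_
    rw [AlgHom.comp_apply, TruncSeries.coeff_map, JetRing.coeff_univ]
    exact hgL.isUnit)
  have h1 : (JetRing.lift m x).comp (JetRing.map m ψ) = g := JetRing.algHom_ext fun i r => by
    rw [AlgHom.comp_apply, JetRing.map_coord, JetRing.lift_coord,
      show x (ψ r) = _ from DFunLike.congr_fun hx r, AlgHom.comp_apply, TruncSeries.coeff_map,
      JetRing.coeff_univ]
  obtain ⟨k, hk⟩ := hgL.exists_lift (JetRing.map m ψ) hunit
  -- A map out of the jet ring of `T` is a jet of `T`, and such a jet is determined by its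
  -- restriction to `R`.
  have h2 : k.comp (JetRing.lift m x) = AlgHom.id ℂ _ := by
    refine (JetRing.homEquiv T m _).injective (h.algHom_ext (AlgHom.ext fun r => ?_))
    refine TruncSeries.ext fun i hi => ?_
    change TruncSeries.coeff _ m i (TruncSeries.map m _ (JetRing.univ T m (ψ r))) =
      TruncSeries.coeff _ m i (TruncSeries.map m _ (JetRing.univ T m (ψ r)))
    rw [TruncSeries.coeff_map, TruncSeries.coeff_map, JetRing.coeff_univ, ← JetRing.map_coord,
      AlgHom.comp_apply, ← AlgHom.comp_apply (JetRing.lift m x), h1, ← AlgHom.comp_apply, hk]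
    rfl
  refine ⟨hunit, fun y => ?_, fun a ha => hgL.ker a ?_⟩
  · obtain ⟨n, a, hn⟩ := hgL.surj (JetRing.lift m x y)
    refine ⟨n, a, ?_⟩
    have e := congrArg k hn
    rw [map_mul, map_pow] at e
    have hk' : ∀ b, k (g b) = JetRing.map m ψ b := fun b => DFunLike.congr_fun hk b
    rw [hk', hk', show k (JetRing.lift m x y) = y from DFunLike.congr_fun h2 y] at e
    exact e
  · rw [← h1, AlgHom.comp_apply, ha, map_zero]

/-! ### Injectivity and surjectivity under localization and gluing -/

section LocalGlobal

variable {A B A' B' : Type*} [CommRing A] [CommRing B] [CommRing A'] [CommRing B']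
  [Algebra ℂ A] [Algebra ℂ B] [Algebra ℂ A'] [Algebra ℂ B']
  {a : A →ₐ[ℂ] A'} {b : B →ₐ[ℂ] B'} {p : A →ₐ[ℂ] B} {p' : A' →ₐ[ℂ] B'} {f : A}

theorem IsAwayMap.surjective (hb : IsAwayMap b (p f)) (ha : IsUnit (a f))
    (hp : ∀ x, p' (a x) = b (p x)) (h : Function.Surjective p) : Function.Surjective p' := by
  intro y
  obtain ⟨n, c, hc⟩ := hb.surj y
  obtain ⟨x, rfl⟩ := h c
  obtain ⟨u, hu⟩ := ha.exists_right_inv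
  refine ⟨u ^ n * a x, ?_⟩
  rw [map_mul, hp, ← hc, ← hp, ← mul_assoc, ← map_pow, ← map_mul, ← mul_pow, mul_comm u, hu,
    one_pow, map_one, one_mul]

theorem IsAwayMap.injective (ha : IsAwayMap a f) (hb : IsAwayMap b (p f))
    (hp : ∀ x, p' (a x) = b (p x)) (h : Function.Injective p) : Function.Injective p' := by
  rw [injective_iff_map_eq_zero] at h ⊢
  intro y hy
  obtain ⟨n, x, hx⟩ := ha.surj y
  obtain ⟨k, hk⟩ := hb.ker (p x) (by rw [← hp, ← hx, map_mul, hy, mul_zero])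
  rw [← map_pow, ← map_mul] at hk
  refine ((ha.isUnit.pow n).mul_right_eq_zero).1 (?_ : _ * y = 0)
  rw [hx]
  refine ((ha.isUnit.pow k).mul_right_eq_zero).1 (?_ : _ * a x = 0)
  rw [← map_pow, ← map_mul, h _ hk, map_zero]

/-- The image of `p` is an `A`-submodule of `B`, and membership in a submodule may be tested after
multiplying by powers of elements generating the unit ideal. -/
theorem surjective_of_span_eq_top {ι : Type*} {f : ι → A} (hf : Ideal.span (Set.range f) = ⊤)
    (h : ∀ y i, ∃ n x, p (f i) ^ n * y = p x) : Function.Surjective p := by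
  intro y
  let := p.toRingHom.toAlgebra
  have : y ∈ LinearMap.range (Algebra.linearMap A B) := by
    refine Submodule.mem_of_span_eq_top_of_smul_pow_mem _ _ hf y ?_
    rintro ⟨_, i, rfl⟩
    obtain ⟨n, x, hx⟩ := h y i
    refine ⟨n, x, ?_⟩
    rw [Algebra.smul_def, map_pow]
    exact hx.symm
  exact this

theorem injective_of_span_eq_top {ι : Type*} {f : ι → A} (hf : Ideal.span (Set.range f) = ⊤)
    (h : ∀ x i, p x = 0 → ∃ n : ℕ, f i ^ n * x = 0) : Function.Injective p := by
  rw [injective_iff_map_eq_zero]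
  intro x hx
  have : x ∈ (⊥ : Ideal A) := by
    refine Submodule.mem_of_span_eq_top_of_smul_pow_mem _ _ hf x ?_
    rintro ⟨_, i, rfl⟩
    exact h x i hx
  exact this

end LocalGlobal

/-! ### Restriction of actions to invariant principal open subsets; goodness -/

namespace AffineAction

variable {H : Type*} [CommRing H] [HopfAlgebra ℂ H] {R T : Type*} [CommRing R] [Algebra ℂ R]
  [CommRing T] [Algebra ℂ T]

/-- `τ` is, via `ψ`, the restriction of the action `σ` to the principal open subset `f ≠ 0`
defined by the invariant `f`. -/
structure IsAway (σ : AffineAction H R) (τ : AffineAction H T) (ψ : R →ₐ[ℂ] T) (f : R) :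
    Prop where
  equivariant : σ.IsEquivariant τ ψ
  mem : f ∈ σ.invariants
  away : IsAwayMap ψ f

theorem IsEquivariant.apply {σ : AffineAction H R} {τ : AffineAction H T} {ψ : R →ₐ[ℂ] T}
    (h : σ.IsEquivariant τ ψ) (x : R) :
    τ.coact (ψ x) = Algebra.TensorProduct.map (AlgHom.id ℂ H) ψ (σ.coact x) :=
  DFunLike.congr_fun h x

theorem mem_invariants {σ : AffineAction H R} {x : R} :
    x ∈ σ.invariants ↔ σ.coact x = 1 ⊗ₜ x := Iff.rfl

theorem IsEquivariant.map_mem_invariants {σ : AffineAction H R} {τ : AffineAction H T}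
    {ψ : R →ₐ[ℂ] T} (h : σ.IsEquivariant τ ψ) {x : R} (hx : x ∈ σ.invariants) :
    ψ x ∈ τ.invariants := by
  rw [mem_invariants] at *
  rw [h.apply, hx, Algebra.TensorProduct.map_tmul, map_one]

/-- By the universal property, both sides are jets of `H ⊗ R`; these agree because they agree on the
two tensor factors. -/
theorem jetProd_naturality (m : ℕ∞) (ψ : R →ₐ[ℂ] T) :
    (jetProd H T m).comp (JetRing.map m (Algebra.TensorProduct.map (AlgHom.id ℂ H) ψ)) =
      (Algebra.TensorProduct.map (AlgHom.id ℂ _) (JetRing.map m ψ)).comp (jetProd H R m) := by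
  let c : JetRing H m ⊗[ℂ] JetRing R m →ₐ[ℂ] JetRing H m ⊗[ℂ] JetRing T m :=
    Algebra.TensorProduct.map (AlgHom.id ℂ _) (JetRing.map m ψ)
  have key : (Algebra.TensorProduct.productMap
      ((TruncSeries.map (A := JetRing H m) (B := JetRing H m ⊗[ℂ] JetRing T m) m
        Algebra.TensorProduct.includeLeft).comp (JetRing.univ H m))
      ((TruncSeries.map (A := JetRing T m) (B := JetRing H m ⊗[ℂ] JetRing T m) m
        Algebra.TensorProduct.includeRight).comp (JetRing.univ T m))).comp
        (Algebra.TensorProduct.map (AlgHom.id ℂ H) ψ) =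
      (TruncSeries.map m c).comp (Algebra.TensorProduct.productMap
      ((TruncSeries.map (A := JetRing H m) (B := JetRing H m ⊗[ℂ] JetRing R m) m
        Algebra.TensorProduct.includeLeft).comp (JetRing.univ H m))
      ((TruncSeries.map (A := JetRing R m) (B := JetRing H m ⊗[ℂ] JetRing R m) m
        Algebra.TensorProduct.includeRight).comp (JetRing.univ R m))) := by
    refine Algebra.TensorProduct.ext (AlgHom.ext fun x => ?_) (AlgHom.ext fun x => ?_) <;>
    refine TruncSeries.ext fun i hi => ?_ <;>
    simp [TruncSeries.coeff_map, JetRing.coeff_univ, c]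
  refine JetRing.algHom_ext fun i z => ?_
  rw [AlgHom.comp_apply, AlgHom.comp_apply, JetRing.map_coord, jetProd, JetRing.lift_coord,
    jetProd, JetRing.lift_coord, ← TruncSeries.coeff_map]
  exact congrArg _ (DFunLike.congr_fun key z)

theorem IsEquivariant.jetCoact {σ : AffineAction H R} {τ : AffineAction H T}
    {ψ : R →ₐ[ℂ] T} (h : σ.IsEquivariant τ ψ) (m : ℕ∞) :
    (τ.jetCoact m).comp (JetRing.map m ψ) =
      (Algebra.TensorProduct.map (AlgHom.id ℂ _) (JetRing.map m ψ)).comp (σ.jetCoact m) := by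
  refine JetRing.algHom_ext fun i x => ?_
  rw [AlgHom.comp_apply, JetRing.map_coord, AffineAction.jetCoact, AlgHom.comp_apply,
    JetRing.map_coord, h.apply, AlgHom.comp_apply, AffineAction.jetCoact, AlgHom.comp_apply,
    JetRing.map_coord, ← JetRing.map_coord]
  exact DFunLike.congr_fun (jetProd_naturality m ψ) _

theorem coord_zero_mem_jetInvariants (σ : AffineAction H R) (m : ℕ∞) {f : R}
    (hf : f ∈ σ.invariants) : JetRing.coord m 0 f ∈ σ.jetInvariants m := by
  have h := σ.map_val_mem_jetInvariants m (JetRing.coord m 0 ⟨f, hf⟩)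
  rwa [JetRing.map_coord] at h

theorem pStar_coord_zero (σ : AffineAction H R) (m : ℕ∞) {f : R} (hf : f ∈ σ.invariants) :
    σ.pStar m (JetRing.coord m 0 ⟨f, hf⟩) =
      ⟨JetRing.coord m 0 f, σ.coord_zero_mem_jetInvariants m hf⟩ :=
  Subtype.ext (JetRing.map_coord m _ _ _)

/-- The map on invariants induced by an equivariant morphism. -/
def IsEquivariant.invariantsMap {σ : AffineAction H R} {τ : AffineAction H T}
    {ψ : R →ₐ[ℂ] T} (h : σ.IsEquivariant τ ψ) : σ.invariants →ₐ[ℂ] τ.invariants :=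
  (ψ.comp σ.invariants.val).codRestrict _ fun x => h.map_mem_invariants x.2

theorem IsEquivariant.map_mem_jetInvariants {σ : AffineAction H R} {τ : AffineAction H T}
    {ψ : R →ₐ[ℂ] T} (h : σ.IsEquivariant τ ψ) (m : ℕ∞) {x : JetRing R m}
    (hx : x ∈ σ.jetInvariants m) : JetRing.map m ψ x ∈ τ.jetInvariants m := by
  have hx' : σ.jetCoact m x = 1 ⊗ₜ x := hx
  change τ.jetCoact m _ = 1 ⊗ₜ _
  rw [← AlgHom.comp_apply, h.jetCoact, AlgHom.comp_apply, hx', Algebra.TensorProduct.map_tmul,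
    map_one]

/-- The map on jet invariants induced by an equivariant morphism. -/
def IsEquivariant.jetInvariantsMap {σ : AffineAction H R} {τ : AffineAction H T}
    {ψ : R →ₐ[ℂ] T} (h : σ.IsEquivariant τ ψ) (m : ℕ∞) :
    σ.jetInvariants m →ₐ[ℂ] τ.jetInvariants m :=
  ((JetRing.map m ψ).comp (σ.jetInvariants m).val).codRestrict _
    fun x => h.map_mem_jetInvariants m x.2

/-- This is the commutative square whose vertical maps become localizations when `ψ` inverts an
invariant. -/
theorem IsEquivariant.pStar_comp {σ : AffineAction H R} {τ : AffineAction H T}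
    {ψ : R →ₐ[ℂ] T} (h : σ.IsEquivariant τ ψ) (m : ℕ∞) (x : JetRing σ.invariants m) :
    τ.pStar m (JetRing.map m h.invariantsMap x) = h.jetInvariantsMap m (σ.pStar m x) := by
  have : (τ.jetInvariants m).val.comp ((τ.pStar m).comp (JetRing.map m h.invariantsMap)) =
      (τ.jetInvariants m).val.comp ((h.jetInvariantsMap m).comp (σ.pStar m)) := by
    refine JetRing.algHom_ext fun i f => ?_
    change JetRing.map m τ.invariants.val (JetRing.map m h.invariantsMap (JetRing.coord m i f)) =
      JetRing.map m ψ (JetRing.map m σ.invariants.val (JetRing.coord m i f))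
    simp only [JetRing.map_coord]
    rfl
  exact Subtype.ext (DFunLike.congr_fun this x)

namespace IsAway

variable {σ : AffineAction H R} {τ : AffineAction H T} {ψ : R →ₐ[ℂ] T} {f : R}

theorem mem_invariants_iff (h : σ.IsAway τ ψ f) (y : T) : y ∈ τ.invariants ↔
    ∃ n : ℕ, ∃ a ∈ σ.invariants, ψ f ^ n * y = ψ a :=
  h.away.mem_equalizer h.equivariant h.mem y

theorem mem_jetInvariants_iff (h : σ.IsAway τ ψ f) (m : ℕ∞) (y : JetRing T m) :
    y ∈ τ.jetInvariants m ↔ ∃ n : ℕ, ∃ a ∈ σ.jetInvariants m,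
      JetRing.map m ψ (JetRing.coord m 0 f) ^ n * y = JetRing.map m ψ a :=
  (h.away.jet m).mem_equalizer (h.equivariant.jetCoact m)
    (σ.coord_zero_mem_jetInvariants m h.mem) y

theorem isAwayMap_invariants (h : σ.IsAway τ ψ f) :
    IsAwayMap h.equivariant.invariantsMap ⟨f, h.mem⟩ :=
  h.away.restrict h.mem_invariants_iff h.mem _ fun _ => rfl

/-- The inverted element is written as a value of `p_m^*` so that both vertical maps of the square
invert the same element of `O((X // G)_m)`. -/
theorem isAwayMap_jetInvariants (h : σ.IsAway τ ψ f) (m : ℕ∞) :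
    IsAwayMap (h.equivariant.jetInvariantsMap m) (σ.pStar m (JetRing.coord m 0 ⟨f, h.mem⟩)) := by
  rw [pStar_coord_zero]
  exact (h.away.jet m).restrict (h.mem_jetInvariants_iff m) _ _ fun _ => rfl

theorem isGood (h : σ.IsAway τ ψ f) {m : ℕ∞} (hσ : σ.IsGood m) : τ.IsGood m :=
  (h.isAwayMap_jetInvariants m).surjective (h.isAwayMap_invariants.jet m).isUnit
    (h.equivariant.pStar_comp m) hσ

theorem isVeryGood (h : σ.IsAway τ ψ f) {m : ℕ∞} (hσ : σ.IsVeryGood m) : τ.IsVeryGood m :=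
  ⟨(h.isAwayMap_invariants.jet m).injective (h.isAwayMap_jetInvariants m)
    (h.equivariant.pStar_comp m) hσ.1, h.isGood hσ.2⟩

end IsAway

section Cover

variable {σ : AffineAction H R} {ι : Type*} {T : ι → Type*} [∀ i, CommRing (T i)]
  [∀ i, Algebra ℂ (T i)] {τ : ∀ i, AffineAction H (T i)} {ψ : ∀ i, R →ₐ[ℂ] T i} {f : ι → R}

theorem span_coord_zero_eq_top {R : Type*} [CommRing R] [Algebra ℂ R] (m : ℕ∞) {f : ι → R}
    (hf : Ideal.span (Set.range f) = ⊤) :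
    Ideal.span (Set.range fun i => JetRing.coord m 0 (f i)) = ⊤ := by
  obtain ⟨c, hc⟩ := JetRing.coord_zero_map (R := R) m
  have := congrArg (Ideal.map c) hf
  rw [Ideal.map_span, Ideal.map_top, ← Set.range_comp] at this
  rw [← this]
  congr 2
  exact funext fun i => (hc _).symm

theorem isGood_of_cover (h : ∀ i, σ.IsAway (τ i) (ψ i) (f i))
    (hf : Ideal.span (Set.range fun i => (⟨f i, (h i).mem⟩ : σ.invariants)) = ⊤) {m : ℕ∞}
    (hτ : ∀ i, (τ i).IsGood m) : σ.IsGood m := by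
  refine surjective_of_span_eq_top (span_coord_zero_eq_top m hf) fun y i => ?_
  -- The restriction of `y` is lifted over the `i`-th chart. The exponent `n` clears the denominator
  -- of the lift, and `k` turns equality after localization into equality upstairs.
  obtain ⟨x', hx'⟩ := hτ i ((h i).equivariant.jetInvariantsMap m y)
  have hA := (h i).isAwayMap_invariants.jet m
  have hB := (h i).isAwayMap_jetInvariants m
  obtain ⟨n, x, hx⟩ := hA.surj x'
  have e : (h i).equivariant.jetInvariantsMap m
      (σ.pStar m (JetRing.coord m 0 ⟨f i, (h i).mem⟩) ^ n * y) =
      (h i).equivariant.jetInvariantsMap m (σ.pStar m x) := by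
    rw [← IsEquivariant.pStar_comp, ← hx, map_mul, map_mul, hx', map_pow, map_pow,
      ← IsEquivariant.pStar_comp]
  obtain ⟨k, hk⟩ := hB.exists_pow_mul_eq e
  refine ⟨k + n, JetRing.coord m 0 ⟨f i, (h i).mem⟩ ^ k * x, ?_⟩
  rw [pow_add, mul_assoc, hk, map_mul, map_pow]

theorem isVeryGood_of_cover (h : ∀ i, σ.IsAway (τ i) (ψ i) (f i))
    (hf : Ideal.span (Set.range fun i => (⟨f i, (h i).mem⟩ : σ.invariants)) = ⊤) {m : ℕ∞}
    (hτ : ∀ i, (τ i).IsVeryGood m) : σ.IsVeryGood m := by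
  refine ⟨injective_of_span_eq_top (span_coord_zero_eq_top m hf) fun x i hx => ?_,
    isGood_of_cover h hf fun i => (hτ i).2⟩
  refine ((h i).isAwayMap_invariants.jet m).ker x ((hτ i).1 ?_)
  rw [IsEquivariant.pStar_comp, hx, map_zero, map_zero]

end Cover

end AffineAction

/-! ### Differential algebras: finite generation under localization and gluing -/

section DiffAdjoin

variable {A B : Type*} [CommRing A] [CommRing B] [Algebra ℂ A] [Algebra ℂ B]
  {D : Derivation ℂ A A} {D' : Derivation ℂ B B}

/-- The differential subalgebra generated by `S`. -/
def diffAdjoin (D : Derivation ℂ A A) (S : Set A) : Subalgebra ℂ A :=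
  Algebra.adjoin ℂ {b | ∃ s ∈ S, ∃ n : ℕ, b = D^[n] s}

theorem subset_diffAdjoin (S : Set A) : S ⊆ diffAdjoin D S :=
  fun s hs => Algebra.subset_adjoin ⟨s, hs, 0, rfl⟩

theorem diffAdjoin_le {S : Set A} {C : Subalgebra ℂ A} (hS : S ⊆ C) (hC : ∀ x ∈ C, D x ∈ C) :
    diffAdjoin D S ≤ C := by
  refine Algebra.adjoin_le ?_
  rintro _ ⟨s, hs, n, rfl⟩
  induction n with
  | zero => exact hS hs
  | succ n ih => rw [Function.iterate_succ_apply']; exact hC _ ih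

theorem derivation_mem_diffAdjoin {S : Set A} {x : A} (hx : x ∈ diffAdjoin D S) :
    D x ∈ diffAdjoin D S := by
  induction hx using Algebra.adjoin_induction with
  | mem x hx =>
    obtain ⟨s, hs, n, rfl⟩ := hx
    exact Algebra.subset_adjoin ⟨s, hs, n + 1, (Function.iterate_succ_apply' _ _ _).symm⟩
  | algebraMap c => rw [D.map_algebraMap]; exact zero_mem _
  | add x y _ _ h1 h2 => rw [map_add]; exact add_mem h1 h2
  | mul x y hx hy h1 h2 =>
    rw [D.leibniz]
    exact add_mem (mul_mem hx h2) (mul_mem hy h1)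

/-- The quotient rule with denominators cleared: if `x ^ n * y` is a numerator of `y`, the
right-hand side is a numerator of `D y`. -/
theorem pow_succ_mul_derivation (x y : A) (n : ℕ) :
    x ^ (n + 1) * D y = x * D (x ^ n * y) - n * D x * (x ^ n * y) := by
  rw [D.leibniz, D.leibniz_pow]
  cases n with
  | zero => simp
  | succ n =>
    simp only [smul_eq_mul, nsmul_eq_mul, Nat.add_sub_cancel]
    ring

/-- The fractions `y` in a localization with numerators in a subalgebra `C`. -/
def fractions (C : Subalgebra ℂ A) (ψ : A →ₐ[ℂ] B) (f : A) (hf : f ∈ C) : Subalgebra ℂ B where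
  carrier := {y | ∃ n : ℕ, ∃ a ∈ C, ψ f ^ n * y = ψ a}
  mul_mem' := by
    rintro x y ⟨n, a, ha, hn⟩ ⟨k, b, hb, hk⟩
    exact ⟨n + k, a * b, mul_mem ha hb, by rw [map_mul, ← hn, ← hk]; ring⟩
  add_mem' := by
    rintro x y ⟨n, a, ha, hn⟩ ⟨k, b, hb, hk⟩
    refine ⟨n + k, f ^ k * a + f ^ n * b,
      add_mem (mul_mem (pow_mem hf _) ha) (mul_mem (pow_mem hf _) hb), ?_⟩
    rw [map_add, map_mul, map_mul, ← hn, ← hk, map_pow, map_pow]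
    ring
  algebraMap_mem' c := ⟨0, algebraMap ℂ A c, algebraMap_mem _ _, by simp⟩

theorem derivation_mem_fractions {C : Subalgebra ℂ A} {ψ : A →ₐ[ℂ] B} {f : A} {hf : f ∈ C}
    (hψ : ∀ x, D' (ψ x) = ψ (D x)) (hC : ∀ x ∈ C, D x ∈ C) {y : B}
    (hy : y ∈ fractions C ψ f hf) : D' y ∈ fractions C ψ f hf := by
  obtain ⟨n, a, ha, hn⟩ := hy
  refine ⟨n + 1, f * D a - n * D f * a, sub_mem (mul_mem hf (hC _ ha))
    (mul_mem (mul_mem (natCast_mem _ n) (hC _ hf)) ha), ?_⟩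
  rw [pow_succ_mul_derivation, hn]
  simp [hψ]

/-- Differential finiteness descends to localizations. -/
theorem diffFinite_fractions {ψ : A →ₐ[ℂ] B} (hψ : ∀ x, D' (ψ x) = ψ (D x)) {f : A}
    (h : IsUnit (ψ f)) {S : Set A} (hS : S.Finite) (hf : f ∈ diffAdjoin D S) :
    ∃ S' : Set B, S'.Finite ∧ fractions (diffAdjoin D S) ψ f hf = diffAdjoin D' S' := by
  obtain ⟨u, hu⟩ := h.exists_right_inv
  -- The inverse of the denominator is the only generator needed besides the images of the old ones.
  refine ⟨insert u (ψ '' S), (hS.image _).insert _, le_antisymm ?_ ?_⟩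
  · rintro y ⟨n, a, ha, hn⟩
    have hle : diffAdjoin D S ≤ (diffAdjoin D' (insert u (ψ '' S))).comap ψ := by
      refine diffAdjoin_le (fun s hs => ?_) fun x hx => ?_
      · exact subset_diffAdjoin _ (Set.mem_insert_of_mem _ ⟨s, hs, rfl⟩)
      · rw [Subalgebra.mem_comap, ← hψ]
        exact derivation_mem_diffAdjoin hx
    have e : y = u ^ n * ψ a := by
      rw [← hn, ← mul_assoc, ← mul_pow, mul_comm u, hu, one_pow, one_mul]
    rw [e]
    exact mul_mem (pow_mem (subset_diffAdjoin _ (Set.mem_insert _ _)) _) (hle ha)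
  · refine diffAdjoin_le (Set.insert_subset ⟨1, 1, one_mem _, by rw [pow_one, hu, map_one]⟩ ?_)
      fun y hy => derivation_mem_fractions hψ (fun x hx => derivation_mem_diffAdjoin hx) hy
    rintro _ ⟨s, hs, rfl⟩
    exact ⟨0, s, subset_diffAdjoin _ hs, by rw [pow_zero, one_mul]⟩

/-- Differential finiteness is local. -/
theorem diffFinite_of_cover {ι : Type*} [Finite ι] {B : ι → Type*} [∀ i, CommRing (B i)]
    [∀ i, Algebra ℂ (B i)] {D' : ∀ i, Derivation ℂ (B i) (B i)} {ψ : ∀ i, A →ₐ[ℂ] B i}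
    (hψ : ∀ i x, D' i (ψ i x) = ψ i (D x)) {f : ι → A} (h : ∀ i, IsAwayMap (ψ i) (f i))
    {C : Subalgebra ℂ A} (hfC : ∀ i, f i ∈ C) {C' : ∀ i, Subalgebra ℂ (B i)}
    (hC : ∀ i, C' i = fractions C (ψ i) (f i) (hfC i))
    (hspan : Ideal.span (Set.range fun i => (⟨f i, hfC i⟩ : C)) = ⊤)
    (hfin : ∀ i, ∃ S : Set (B i), S.Finite ∧ C' i = diffAdjoin (D' i) S) :
    ∃ S : Set A, S.Finite ∧ C = diffAdjoin D S := by
  have := Fintype.ofFinite ι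
  choose S hS hCS using hfin
  have hnum : ∀ i, ∀ s : S i, ∃ (n : ℕ) (a : A), a ∈ C ∧ ψ i (f i) ^ n * s = ψ i a := fun i s => by
    have : (s : B i) ∈ fractions C (ψ i) (f i) (hfC i) := by
      rw [← hC, hCS]; exact subset_diffAdjoin _ s.2
    exact this
  choose N a haC ha using hnum
  obtain ⟨c, hc⟩ := (Ideal.mem_span_range_iff_exists_fun (R := C)).1
    ((Ideal.eq_top_iff_one _).1 hspan)
  -- The generators are the denominators, the coefficients of the partition of unity `∑ c i * f i =
  -- 1`, and one numerator for each local generator. The first two kinds allow gluing inside the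
  -- differential algebra they generate.
  let G : Set A := Set.range f ∪ Set.range (fun i => (c i : A)) ∪ ⋃ i, Set.range (a i)
  have hGfin : G.Finite := by
    refine ((Set.finite_range _).union (Set.finite_range _)).union (Set.finite_iUnion fun i => ?_)
    have := (hS i).to_subtype
    exact Set.finite_range _
  have hGf : ∀ i, f i ∈ diffAdjoin D G :=
    fun i => subset_diffAdjoin _ (Or.inl (Or.inl ⟨i, rfl⟩))
  have hGc : ∀ i, (c i : A) ∈ diffAdjoin D G :=
    fun i => subset_diffAdjoin _ (Or.inl (Or.inr ⟨i, rfl⟩))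
  have hGa : ∀ i s, a i s ∈ diffAdjoin D G :=
    fun i s => subset_diffAdjoin _ (Or.inr (Set.mem_iUnion.2 ⟨i, s, rfl⟩))
  have hc' : ∑ i, (c i : A) * f i = 1 := by
    have := congrArg (Subalgebra.val C) hc
    rw [map_sum, map_one] at this
    exact this
  have local_mem : ∀ (E : Subalgebra ℂ A) (x : A), (∀ i, f i ∈ E) → (∀ i, (c i : A) ∈ E) →
      (∀ i, ∃ n : ℕ, f i ^ n * x ∈ E) → x ∈ E := fun E x hf hcE hx =>
    Subalgebra.mem_of_finsetSum_eq_one_of_pow_smul_mem E Finset.univ f (fun i => (c i : A)) hc'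
      hf hcE x hx
  refine ⟨G, hGfin, le_antisymm (fun x hx => ?_) fun x hx => ?_⟩
  · refine local_mem _ x hGf hGc fun i => ?_
    -- Fractions with numerators in the candidate algebra are closed under the derivation and
    -- contain the local generators.
    have hle : C' i ≤ fractions (diffAdjoin D G) (ψ i) (f i) (hGf i) := by
      rw [hCS]
      exact diffAdjoin_le (fun s hs => ⟨N i ⟨s, hs⟩, a i ⟨s, hs⟩, hGa i _, ha i ⟨s, hs⟩⟩)
        fun y hy => derivation_mem_fractions (hψ i) (fun x hx => derivation_mem_diffAdjoin hx) hy
    have hxC : ψ i x ∈ C' i := by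
      rw [hC]; exact ⟨0, x, hx, by rw [pow_zero, one_mul]⟩
    obtain ⟨n, b, hb, hn⟩ := hle hxC
    rw [← map_pow, ← map_mul] at hn
    obtain ⟨k, hk⟩ := (h i).exists_pow_mul_eq hn
    refine ⟨k + n, ?_⟩
    rw [pow_add, mul_assoc, hk]
    exact mul_mem (pow_mem (hGf i) _) hb
  · refine local_mem _ x hfC (fun i => (c i).2) fun i => ?_
    -- It is not known beforehand that `D` preserves `C`. But each `C' i` is differentially closed,
    -- so the derivatives of `G` lie in every `C' i`, and hence in `C` by gluing.
    have hle : diffAdjoin D G ≤ (C' i).comap (ψ i) := by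
      refine diffAdjoin_le ?_ fun y hy => ?_
      · have hCle : ∀ y ∈ C, y ∈ (C' i).comap (ψ i) := fun y hy => by
          rw [Subalgebra.mem_comap, hC]; exact ⟨0, y, hy, by rw [pow_zero, one_mul]⟩
        rintro _ ((⟨j, rfl⟩ | ⟨j, rfl⟩) | hs)
        · exact hCle _ (hfC j)
        · exact hCle _ (c j).2
        · obtain ⟨j, s, rfl⟩ := Set.mem_iUnion.1 hs
          exact hCle _ (haC j s)
      · rw [Subalgebra.mem_comap, ← hψ, hCS]
        rw [Subalgebra.mem_comap, hCS] at hy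
        exact derivation_mem_diffAdjoin hy
    have hxC := hle hx
    rw [Subalgebra.mem_comap, hC] at hxC
    obtain ⟨n, b, hb, hn⟩ := hxC
    rw [← map_pow, ← map_mul] at hn
    obtain ⟨k, hk⟩ := (h i).exists_pow_mul_eq hn
    refine ⟨k + n, ?_⟩
    rw [pow_add, mul_assoc, hk]
    exact mul_mem (pow_mem (hfC i) _) hb

end DiffAdjoin

/-! ### The derivation on arcs and D-finiteness -/

theorem arcDerivation_mk {R : Type*} [CommRing R] [Algebra ℂ R] (a : MvPolynomial (ℕ × R) ℂ) :
    arcDerivation R (JetRing.mk R ⊤ a) = JetRing.mk R ⊤ (arcDerivationAux R a) := by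
  unfold arcDerivation
  rw [Derivation.liftOfSurjective_apply]

theorem arcDerivation_coord {R : Type*} [CommRing R] [Algebra ℂ R] (i : ℕ) (f : R) :
    arcDerivation R (JetRing.coord ⊤ i f) = (i + 1) • JetRing.coord ⊤ (i + 1) f := by
  rw [JetRing.coord, arcDerivation_mk, arcDerivationAux, MvPolynomial.mkDerivation_X, map_nsmul]
  rfl

theorem arcDerivation_map {R T : Type*} [CommRing R] [Algebra ℂ R] [CommRing T] [Algebra ℂ T]
    (ψ : R →ₐ[ℂ] T) (x : JetRing R ⊤) :
    arcDerivation T (JetRing.map ⊤ ψ x) = JetRing.map ⊤ ψ (arcDerivation R x) := by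
  obtain ⟨a, rfl⟩ := JetRing.mk_surjective R ⊤ x
  induction a using MvPolynomial.induction_on with
  | C c =>
    have e : JetRing.mk R ⊤ (MvPolynomial.C c) = algebraMap ℂ _ c := (JetRing.mk R ⊤).commutes c
    rw [e, AlgHom.commutes, Derivation.map_algebraMap, Derivation.map_algebraMap, map_zero]
  | add p q hp hq => simp only [map_add, hp, hq]
  | mul_X p j hp =>
    have hX : JetRing.mk R ⊤ (MvPolynomial.X j) = JetRing.coord ⊤ j.1 j.2 := rfl
    rw [map_mul, map_mul, Derivation.leibniz, hp, Derivation.leibniz, hX, JetRing.map_coord,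
      arcDerivation_coord, arcDerivation_coord]
    simp

namespace AffineAction

variable {H : Type*} [CommRing H] [HopfAlgebra ℂ H] {R : Type*} [CommRing R] [Algebra ℂ R]

theorem IsAway.jetInvariants_eq_fractions {T : Type*} [CommRing T] [Algebra ℂ T]
    {σ : AffineAction H R} {τ : AffineAction H T} {ψ : R →ₐ[ℂ] T} {f : R}
    (h : σ.IsAway τ ψ f) (m : ℕ∞) : τ.jetInvariants m = fractions (σ.jetInvariants m)
      (JetRing.map m ψ) (JetRing.coord m 0 f) (σ.coord_zero_mem_jetInvariants m h.mem) :=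
  SetLike.ext (h.mem_jetInvariants_iff m)

theorem IsAway.isDFinite {T : Type*} [CommRing T] [Algebra ℂ T]
    {σ : AffineAction H R} {τ : AffineAction H T} {ψ : R →ₐ[ℂ] T} {f : R}
    (h : σ.IsAway τ ψ f) (hσ : σ.IsDFinite) : τ.IsDFinite := by
  obtain ⟨S, hS, e⟩ := hσ
  have hf := σ.coord_zero_mem_jetInvariants ⊤ h.mem
  rw [e] at hf
  obtain ⟨S', hS', e'⟩ := diffFinite_fractions (D := arcDerivation R) (D' := arcDerivation T)
    (arcDerivation_map ψ) (h.away.jet ⊤).isUnit hS hf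
  refine ⟨S', hS', ?_⟩
  rw [h.jetInvariants_eq_fractions]
  simp only [e]
  exact e'

variable {σ : AffineAction H R} {ι : Type*} {T : ι → Type*} [∀ i, CommRing (T i)]
  [∀ i, Algebra ℂ (T i)] {τ : ∀ i, AffineAction H (T i)} {ψ : ∀ i, R →ₐ[ℂ] T i} {f : ι → R}

theorem isDFinite_of_finite_cover [Finite ι] (h : ∀ i, σ.IsAway (τ i) (ψ i) (f i))
    (hf : Ideal.span (Set.range fun i => (⟨f i, (h i).mem⟩ : σ.invariants)) = ⊤)
    (hτ : ∀ i, (τ i).IsDFinite) : σ.IsDFinite := by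
  have hf' : Ideal.span (Set.range fun i => (⟨JetRing.coord ⊤ 0 (f i),
      σ.coord_zero_mem_jetInvariants ⊤ (h i).mem⟩ : σ.jetInvariants ⊤)) = ⊤ := by
    have e := congrArg (Ideal.map (σ.pStar ⊤)) (span_coord_zero_eq_top ⊤ hf)
    rw [Ideal.map_span, Ideal.map_top, ← Set.range_comp] at e
    simp only [Function.comp_def, pStar_coord_zero] at e
    exact e
  have h1 : ∀ i, IsAwayMap (JetRing.map ⊤ (ψ i)) (JetRing.coord ⊤ 0 (f i)) :=
    fun i => (h i).away.jet ⊤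
  have h2 := fun i => (h i).jetInvariants_eq_fractions ⊤
  have h3 := fun i => arcDerivation_map (ψ i)
  unfold IsDFinite at hτ ⊢
  exact diffFinite_of_cover h3 h1 _ h2 hf' hτ

theorem isDFinite_of_cover (h : ∀ i, σ.IsAway (τ i) (ψ i) (f i))
    (hf : Ideal.span (Set.range fun i => (⟨f i, (h i).mem⟩ : σ.invariants)) = ⊤)
    (hτ : ∀ i, (τ i).IsDFinite) : σ.IsDFinite := by
  -- The element `1` is a combination of finitely many of the invariants, so a finite subcover
  -- remains and the global generating set stays finite.
  obtain ⟨s, hs, hspan⟩ := Submodule.mem_span_finite_of_mem_span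
    ((Ideal.eq_top_iff_one _).1 hf)
  choose j hj using fun x : s => hs x.2
  refine isDFinite_of_finite_cover (ι := s) (fun x => h (j x)) ?_ fun x => hτ (j x)
  rw [Ideal.eq_top_iff_one]
  convert! hspan
  exact (congrArg Set.range (funext hj)).trans Subtype.range_coe

end AffineAction

/-! ### Contractions of tensors and their supports -/

section Contraction

variable {M N : Type*} [AddCommGroup M] [Module ℂ M] [AddCommGroup N] [Module ℂ N]

theorem exists_finite_mem_range_rTensor (z : M ⊗[ℂ] N) :
    ∃ F : Finset M, z ∈ LinearMap.range ((Submodule.span ℂ (F : Set M)).subtype.rTensor N) := by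
  classical
  obtain ⟨S, rfl⟩ := TensorProduct.exists_finset z
  refine ⟨S.image Prod.fst, sum_mem fun i hi => ?_⟩
  exact ⟨⟨i.1, Submodule.subset_span (Finset.mem_coe.2 (Finset.mem_image_of_mem _ hi))⟩ ⊗ₜ i.2,
    rfl⟩

theorem range_rTensor_mono {V V' : Submodule ℂ M} (h : V ≤ V') :
    LinearMap.range (V.subtype.rTensor N) ≤ LinearMap.range (V'.subtype.rTensor N) := by
  rintro _ ⟨z, rfl⟩
  refine ⟨(Submodule.inclusion h).rTensor N z, ?_⟩
  rw [← LinearMap.comp_apply, ← LinearMap.rTensor_comp, Submodule.subtype_comp_inclusion]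

/-- Contraction of `M ⊗ N` with a linear form on `N`. -/
def contractRight (M : Type*) {N : Type*} [AddCommGroup M] [Module ℂ M] [AddCommGroup N]
    [Module ℂ N] (β : N →ₗ[ℂ] ℂ) : M ⊗[ℂ] N →ₗ[ℂ] M :=
  (TensorProduct.rid ℂ M).toLinearMap ∘ₗ β.lTensor M

@[simp] theorem contractRight_tmul (β : N →ₗ[ℂ] ℂ) (m : M) (n : N) :
    contractRight M β (m ⊗ₜ n) = β n • m := by
  simp [contractRight]

/-- Contraction of `M ⊗ N` with a linear form on `M`. -/
def contractLeft {M : Type*} (N : Type*) [AddCommGroup M] [Module ℂ M] [AddCommGroup N]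
    [Module ℂ N] (β : M →ₗ[ℂ] ℂ) : M ⊗[ℂ] N →ₗ[ℂ] N :=
  (TensorProduct.lid ℂ N).toLinearMap ∘ₗ β.rTensor N

@[simp] theorem contractLeft_tmul (β : M →ₗ[ℂ] ℂ) (m : M) (n : N) :
    contractLeft N β (m ⊗ₜ n) = β m • n := by
  simp [contractLeft]

/-- The smallest subspace `V` of `M` with `z ∈ V ⊗ N`. -/
def leftSupport (z : M ⊗[ℂ] N) : Submodule ℂ M :=
  Submodule.span ℂ (Set.range fun β : N →ₗ[ℂ] ℂ => contractRight M β z)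

theorem contractRight_mem {V : Submodule ℂ M} {z : M ⊗[ℂ] N}
    (hz : z ∈ LinearMap.range (V.subtype.rTensor N)) (β : N →ₗ[ℂ] ℂ) :
    contractRight M β z ∈ V := by
  obtain ⟨w, rfl⟩ := hz
  induction w with
  | zero => simp
  | add x y hx hy => rw [map_add, map_add]; exact add_mem hx hy
  | tmul v n =>
    rw [LinearMap.rTensor_tmul, contractRight_tmul]
    exact V.smul_mem _ v.2

theorem finiteDimensional_leftSupport (z : M ⊗[ℂ] N) : FiniteDimensional ℂ (leftSupport z) := by
  obtain ⟨F, hF⟩ := exists_finite_mem_range_rTensor z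
  refine Submodule.finiteDimensional_of_le (S₂ := Submodule.span ℂ (F : Set M))
    (Submodule.span_le.2 ?_)
  rintro _ ⟨β, rfl⟩
  exact contractRight_mem hF β

/-- Expanding `z` in a basis of `N`, the coefficients are the contractions of `z` with the
coordinate forms. -/
theorem mem_range_rTensor_leftSupport (z : M ⊗[ℂ] N) :
    z ∈ LinearMap.range ((leftSupport z).subtype.rTensor N) := by
  classical
  let b := Module.Basis.ofVectorSpace ℂ N
  have h : z = ∑ i ∈ (TensorProduct.equivFinsuppOfBasisRight b z).support,
      contractRight M (b.coord i) z ⊗ₜ b i := by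
    have e : ∀ w : M ⊗[ℂ] N, ∀ i, TensorProduct.equivFinsuppOfBasisRight b w i =
        contractRight M (b.coord i) w := by
      intro w i
      induction w with
      | zero => simp
      | add x y hx hy => rw [map_add, map_add, Finsupp.add_apply, hx, hy]
      | tmul m n => simp
    conv_lhs => rw [← (TensorProduct.equivFinsuppOfBasisRight b).symm_apply_apply z]
    rw [TensorProduct.equivFinsuppOfBasisRight_symm_apply]
    exact Finset.sum_congr rfl fun i _ => by rw [e]
  rw [h]
  refine sum_mem fun i _ => ?_
  rw [← h]
  exact ⟨⟨_, Submodule.subset_span ⟨b.coord i, rfl⟩⟩ ⊗ₜ b i, rfl⟩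

end Contraction

/-! ### Finite dimensional subcomodules and invariant integrals -/

section Integral

variable {H : Type*} [CommRing H] [HopfAlgebra ℂ H]

/-- `V` is a subcomodule of `H`, i.e. it is stable under translations. -/
def IsSubcomodule (V : Submodule ℂ H) : Prop :=
  ∀ v ∈ V, Coalgebra.comul (R := ℂ) v ∈ LinearMap.range (V.subtype.rTensor H)

/-- Coassociativity. Since the operator on the right acts only on the second factor of `Δ h`, the
left support of `Δ h` is stable under comultiplication. -/
theorem comul_contractRight_comul (β : H →ₗ[ℂ] ℂ) (h : H) :
    Coalgebra.comul (R := ℂ) (contractRight H β (Coalgebra.comul (R := ℂ) h)) =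
      (contractRight H β ∘ₗ Coalgebra.comul).lTensor H (Coalgebra.comul (R := ℂ) h) := by
  have h1 : ∀ z : H ⊗[ℂ] H, Coalgebra.comul (R := ℂ) (contractRight H β z) =
      (contractRight H β).lTensor H
        (TensorProduct.assoc ℂ H H H ((Coalgebra.comul (R := ℂ)).rTensor H z)) := by
    intro z
    induction z with
    | zero => simp
    | add x y hx hy => simp only [map_add, hx, hy]
    | tmul x y =>
      rw [LinearMap.rTensor_tmul, contractRight_tmul, map_smul]
      induction Coalgebra.comul (R := ℂ) x with
      | zero => simp
      | add a b ha hb => simp only [TensorProduct.add_tmul, map_add, smul_add, ha, hb]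
      | tmul a b => simp
  rw [h1, Coalgebra.coassoc_apply, ← LinearMap.comp_apply, ← LinearMap.lTensor_comp]

/-- The left support of `Δ h` is the span of the translates of `h`; it contains `h` itself because
contracting with the counit, that is, evaluating at the identity of `G`, returns `h`. -/
theorem exists_isSubcomodule_mem (h : H) :
    ∃ V : Submodule ℂ H, FiniteDimensional ℂ V ∧ IsSubcomodule V ∧ h ∈ V := by
  let z := Coalgebra.comul (R := ℂ) h
  refine ⟨leftSupport z, finiteDimensional_leftSupport z, fun v hv => ?_, ?_⟩
  · induction hv using Submodule.span_induction with
    | mem v hv =>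
      obtain ⟨β, rfl⟩ := hv
      obtain ⟨w, hw⟩ := mem_range_rTensor_leftSupport z
      refine ⟨(contractRight H β ∘ₗ Coalgebra.comul).lTensor _ w, ?_⟩
      rw [comul_contractRight_comul]
      conv_rhs => rw [show Coalgebra.comul (R := ℂ) h = z from rfl, ← hw]
      rw [← LinearMap.comp_apply, ← LinearMap.comp_apply, LinearMap.rTensor_comp_lTensor,
        LinearMap.lTensor_comp_rTensor]
    | zero => rw [map_zero]; exact zero_mem _
    | add x y _ _ hx hy => rw [map_add]; exact add_mem hx hy
    | smul c x _ hx => rw [map_smul]; exact Submodule.smul_mem _ c hx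
  · refine Submodule.subset_span ⟨Coalgebra.counit, ?_⟩
    change TensorProduct.rid ℂ H (Coalgebra.counit.lTensor H (Coalgebra.comul (R := ℂ) h)) = h
    rw [Coalgebra.lTensor_counit_comul, TensorProduct.rid_tmul, one_smul]

theorem IsSubcomodule.sup {V V' : Submodule ℂ H} (hV : IsSubcomodule V) (hV' : IsSubcomodule V') :
    IsSubcomodule (V ⊔ V') := by
  intro x hx
  obtain ⟨v, hv, v', hv', rfl⟩ := Submodule.mem_sup.1 hx
  rw [map_add]
  exact add_mem (range_rTensor_mono le_sup_left (hV v hv))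
    (range_rTensor_mono le_sup_right (hV' v' hv'))

theorem exists_isSubcomodule_subset (F : Finset H) :
    ∃ V : Submodule ℂ H, FiniteDimensional ℂ V ∧ IsSubcomodule V ∧ (F : Set H) ⊆ V := by
  classical
  induction F using Finset.induction_on with
  | empty => exact ⟨⊥, inferInstance, fun v hv => by
      rw [(Submodule.mem_bot ℂ).1 hv, map_zero]; exact zero_mem _, by simp⟩
  | insert h F _ ih =>
    obtain ⟨V, _, hV, hFV⟩ := ih
    obtain ⟨V', _, hV', hh⟩ := exists_isSubcomodule_mem h
    refine ⟨V' ⊔ V, inferInstance, hV'.sup hV, ?_⟩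
    rw [Finset.coe_insert]
    exact Set.insert_subset (Submodule.mem_sup_left hh)
      (hFV.trans fun x hx => Submodule.mem_sup_right hx)

theorem rTensor_injective {W M : Type*} [AddCommGroup W] [Module ℂ W] [AddCommGroup M]
    [Module ℂ M] (N : Type*) [AddCommGroup N] [Module ℂ N] {i : W →ₗ[ℂ] M}
    (hi : Function.Injective i) : Function.Injective (i.rTensor N) :=
  Module.Flat.rTensor_preserves_injective_linearMap i hi

/-- A subcomodule of `H`, as a rational representation. -/
theorem exists_rep_of_injective {W : Type*} [AddCommGroup W] [Module ℂ W] (i : W →ₗ[ℂ] H)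
    (hi : Function.Injective i)
    (hc : ∀ w, Coalgebra.comul (R := ℂ) (i w) ∈ LinearMap.range (i.rTensor H)) :
    ∃ ρ : Rep H W, ∀ w, i.rTensor H (ρ.coact w) = Coalgebra.comul (R := ℂ) (i w) := by
  let e := LinearEquiv.ofInjective (i.rTensor H) (rTensor_injective H hi)
  let c : W →ₗ[ℂ] W ⊗[ℂ] H := e.symm.toLinearMap ∘ₗ
    (Coalgebra.comul (R := ℂ) ∘ₗ i).codRestrict _ hc
  have hcw : ∀ w, i.rTensor H (c w) = Coalgebra.comul (R := ℂ) (i w) := fun w =>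
    congrArg Subtype.val (e.apply_symm_apply ⟨_, hc w⟩)
  -- The comodule axioms are those of `H`, tested after the injections induced by `i`.
  refine ⟨⟨c, LinearMap.ext fun w => rTensor_injective (H ⊗[ℂ] H) hi ?_,
    LinearMap.ext fun w => hi ?_⟩, hcw⟩
  · have h1 : ∀ z : W ⊗[ℂ] H, i.rTensor (H ⊗[ℂ] H) (TensorProduct.assoc ℂ W H H (c.rTensor H z)) =
        TensorProduct.assoc ℂ H H H ((Coalgebra.comul (R := ℂ)).rTensor H (i.rTensor H z)) := by
      intro z
      induction z with
      | zero => simp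
      | add x y hx hy => simp only [map_add, hx, hy]
      | tmul x y =>
        rw [LinearMap.rTensor_tmul, LinearMap.rTensor_tmul, LinearMap.rTensor_tmul, ← hcw]
        induction c x with
        | zero => simp
        | add a b ha hb => simp only [TensorProduct.add_tmul, map_add, ha, hb]
        | tmul a b => simp
    change i.rTensor (H ⊗[ℂ] H) (TensorProduct.assoc ℂ W H H (c.rTensor H (c w))) =
      i.rTensor (H ⊗[ℂ] H) ((Coalgebra.comul (R := ℂ)).lTensor W (c w))
    rw [h1, hcw, Coalgebra.coassoc_apply, ← hcw, ← LinearMap.comp_apply,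
      LinearMap.lTensor_comp_rTensor, ← LinearMap.comp_apply (i.rTensor (H ⊗[ℂ] H)),
      LinearMap.rTensor_comp_lTensor]
  · have h1 : ∀ z : W ⊗[ℂ] H, i (contractRight W Coalgebra.counit z) =
        contractRight H Coalgebra.counit (i.rTensor H z) := by
      intro z
      induction z with
      | zero => simp
      | add x y hx hy => simp only [map_add, hx, hy]
      | tmul x y => simp
    change i (contractRight W Coalgebra.counit (c w)) = i w
    rw [h1, hcw]
    change TensorProduct.rid ℂ H (Coalgebra.counit.lTensor H (Coalgebra.comul (R := ℂ) (i w))) = _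
    rw [Coalgebra.lTensor_counit_comul, TensorProduct.rid_tmul, one_smul]

/-- The line through the invariant vector `u` has a stable complement. Projecting along it onto the
line and then applying `t` gives an invariant form; the final identity expresses that invariance. -/
theorem IsReductive.exists_linearMap (hG : IsReductive H) {W : Type} [AddCommGroup W] [Module ℂ W]
    [FiniteDimensional ℂ W] (ρ : Rep H W) {u : W} (hρu : ρ.coact u = u ⊗ₜ 1)
    {t : W →ₗ[ℂ] ℂ} (ht : t u = 1) :
    ∃ l : W →ₗ[ℂ] ℂ, l u = 1 ∧ ∀ w, contractLeft H l (ρ.coact w) = l w • (1 : H) := by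
  let N := Submodule.span ℂ {u}
  obtain ⟨N', hN', hcompl⟩ := hG _ ρ N (by
    intro w hw
    obtain ⟨a, rfl⟩ := Submodule.mem_span_singleton.1 hw
    refine ⟨(⟨a • u, hw⟩ : N) ⊗ₜ 1, ?_⟩
    rw [map_smul, hρu]
    rfl)
  let l : W →ₗ[ℂ] ℂ := t ∘ₗ N.projection N' hcompl
  have hlu : l u = 1 := by
    have : N.projection N' hcompl u = u :=
      Submodule.projection_apply_left hcompl ⟨u, Submodule.mem_span_singleton_self u⟩
    rw [LinearMap.comp_apply, this, ht]
  have hlN' : l ∘ₗ N'.subtype = 0 := LinearMap.ext fun x => by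
    simp [l]
  refine ⟨l, hlu, fun w => ?_⟩
  obtain ⟨n, hn, n', hn', rfl⟩ := Submodule.mem_sup.1
    (show w ∈ N ⊔ N' by rw [hcompl.sup_eq_top]; trivial)
  obtain ⟨a, rfl⟩ := Submodule.mem_span_singleton.1 hn
  have h2 : contractLeft H l (ρ.coact n') = 0 := by
    obtain ⟨z, hz⟩ := hN' n' hn'
    rw [← hz, contractLeft, LinearMap.comp_apply, ← LinearMap.comp_apply (l.rTensor H),
      ← LinearMap.rTensor_comp, hlN']
    simp
  have h3 : l n' = 0 := DFunLike.congr_fun hlN' ⟨n', hn'⟩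
  simp only [map_add, map_smul, hρu, h2, h3, contractLeft_tmul, hlu]
  simp

/-- A reductive group has an invariant integral, at least on any finite set of functions. -/
theorem IsReductive.exists_integral (hG : IsReductive H) (F : Finset H) :
    ∃ l : H →ₗ[ℂ] ℂ, l 1 = 1 ∧
      ∀ h ∈ F, contractLeft H l (Coalgebra.comul (R := ℂ) h) = l h • (1 : H) := by
  classical
  -- The constant `1` is included because it serves as the invariant vector that normalizes the
  -- integral.
  obtain ⟨V, _, hV, hFV⟩ := exists_isSubcomodule_subset (insert 1 F)
  -- `IsReductive` speaks of representations in `Type`, so `V` is replaced by a coordinate space.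
  obtain ⟨n, ⟨e⟩⟩ : ∃ n, Nonempty ((Fin n → ℂ) ≃ₗ[ℂ] V) :=
    ⟨_, ⟨(Module.finBasis ℂ V).equivFun.symm⟩⟩
  obtain ⟨i, hi'⟩ : ∃ i : (Fin n → ℂ) →ₗ[ℂ] H, ∀ w, i w = e w :=
    ⟨V.subtype ∘ₗ e.toLinearMap, fun _ => rfl⟩
  have hi : Function.Injective i := fun x y hxy => e.injective (Subtype.ext (by
    rwa [hi', hi'] at hxy))
  have hiV : ∀ v ∈ V, ∃ w, i w = v := fun v hv => ⟨e.symm ⟨v, hv⟩, by simp [hi']⟩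
  obtain ⟨ρ, hρ⟩ := exists_rep_of_injective i hi fun w => by
    obtain ⟨z, hz⟩ := hV (i w) (by rw [hi']; exact (e w).2)
    refine ⟨e.symm.toLinearMap.rTensor H z, ?_⟩
    rw [← hz, ← LinearMap.comp_apply, ← LinearMap.rTensor_comp]
    congr 2
    ext v
    simp [hi']
  obtain ⟨u, hu⟩ := hiV 1 (hFV (by simp))
  have hρu : ρ.coact u = u ⊗ₜ 1 := rTensor_injective H hi (by
    rw [hρ, LinearMap.rTensor_tmul, hu, Bialgebra.comul_one]; rfl)
  obtain ⟨π, hπ⟩ := LinearMap.exists_leftInverse_of_injective i (LinearMap.ker_eq_bot.2 hi)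
  obtain ⟨l0, hl0u, hl0⟩ := hG.exists_linearMap ρ hρu (t := Coalgebra.counit ∘ₗ i) (by
    rw [LinearMap.comp_apply, hu, Bialgebra.counit_one])
  have hl : ∀ w, (l0 ∘ₗ π) (i w) = l0 w := fun w =>
    congrArg l0 (DFunLike.congr_fun hπ w)
  refine ⟨l0 ∘ₗ π, by rw [← hu, hl, hl0u], fun h hh => ?_⟩
  obtain ⟨w, rfl⟩ := hiV h (hFV (by simp [hh]))
  have h1 : ∀ z, contractLeft H (l0 ∘ₗ π) (i.rTensor H z) = contractLeft H l0 z := by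
    intro z
    induction z with
    | zero => simp only [map_zero]
    | add x y hx hy => simp only [map_add, hx, hy]
    | tmul x y => rw [LinearMap.rTensor_tmul, contractLeft_tmul, hl, contractLeft_tmul]
  rw [← hρ, h1, hl, hl0]

end Integral

/-! ### Reynolds operators and saturated open sets -/

section Reynolds

variable {H : Type*} [CommRing H] [HopfAlgebra ℂ H] {R : Type*} [CommRing R] [Algebra ℂ R]

namespace AffineAction

/-- An ideal is `G`-stable if the closed subscheme it defines is. -/
def IsStableIdeal (σ : AffineAction H R) (J : Ideal R) : Prop :=
  ∀ r ∈ J, Algebra.TensorProduct.map (AlgHom.id ℂ H) (Ideal.Quotient.mkₐ ℂ J) (σ.coact r) = 0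

theorem coassoc_apply (σ : AffineAction H R) (r : R) :
    Algebra.TensorProduct.assoc ℂ ℂ ℂ H H R (Algebra.TensorProduct.map (Bialgebra.comulAlgHom ℂ H)
      (AlgHom.id ℂ R) (σ.coact r)) =
    Algebra.TensorProduct.map (AlgHom.id ℂ H) σ.coact (σ.coact r) :=
  DFunLike.congr_fun σ.coassoc r

theorem contractLeft_one_tmul_mul (l : H →ₗ[ℂ] ℂ) (f : R) (z : H ⊗[ℂ] R) :
    contractLeft R l (1 ⊗ₜ f * z) = f * contractLeft R l z := by
  induction z with
  | zero => simp
  | add x y hx hy => simp only [mul_add, map_add, hx, hy]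
  | tmul h x => simp

theorem contractLeft_map {S : Type*} [CommRing S] [Algebra ℂ S] (l : H →ₗ[ℂ] ℂ) (g : R →ₐ[ℂ] S)
    (z : H ⊗[ℂ] R) : contractLeft S l (Algebra.TensorProduct.map (AlgHom.id ℂ H) g z) =
      g (contractLeft R l z) := by
  induction z with
  | zero => simp
  | add x y hx hy => simp only [map_add, hx, hy]
  | tmul h x => simp

/-- Invariance of `l` extends linearly from `F` to its span. Applied to `z = σ.coact r`, the
identity shows that averaging `r` over the group yields an invariant. -/
theorem contractLeft_comul {l : H →ₗ[ℂ] ℂ} {F : Set H}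
    (hl : ∀ h ∈ F, contractLeft H l (Coalgebra.comul (R := ℂ) h) = l h • (1 : H))
    {z : H ⊗[ℂ] R} (hz : z ∈ LinearMap.range ((Submodule.span ℂ F).subtype.rTensor R)) :
    contractLeft (H ⊗[ℂ] R) l (Algebra.TensorProduct.assoc ℂ ℂ ℂ H H R
      (Algebra.TensorProduct.map (Bialgebra.comulAlgHom ℂ H) (AlgHom.id ℂ R) z)) =
      1 ⊗ₜ contractLeft R l z := by
  have hl' : ∀ h ∈ Submodule.span ℂ F,
      contractLeft H l (Coalgebra.comul (R := ℂ) h) = l h • (1 : H) := fun h hh => by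
    induction hh using Submodule.span_induction with
    | mem h hh => exact hl h hh
    | zero => simp
    | add x y _ _ hx hy => rw [map_add, map_add, hx, hy, map_add, add_smul]
    | smul c x _ hx => rw [map_smul, map_smul, hx, map_smul, smul_assoc]
  have h1 : ∀ (w : H ⊗[ℂ] H) (x : R), contractLeft (H ⊗[ℂ] R) l
      (Algebra.TensorProduct.assoc ℂ ℂ ℂ H H R (w ⊗ₜ x)) = contractLeft H l w ⊗ₜ x := by
    intro w x
    induction w with
    | zero => simp
    | add a b ha hb => simp only [TensorProduct.add_tmul, map_add, ha, hb]
    | tmul a b => simp [TensorProduct.smul_tmul']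
  obtain ⟨w, rfl⟩ := hz
  induction w with
  | zero => simp
  | add x y hx hy => simp only [map_add, TensorProduct.tmul_add, hx, hy]
  | tmul h x =>
    rw [LinearMap.rTensor_tmul, Algebra.TensorProduct.map_tmul, AlgHom.id_apply, h1,
      Bialgebra.comulAlgHom_apply, Submodule.subtype_apply, hl' h h.2, contractLeft_tmul,
      TensorProduct.smul_tmul]

/-- The Reynolds operator. -/
theorem exists_reynolds (hG : IsReductive H) (σ : AffineAction H R) (s : Finset R) :
    ∃ E : R →ₗ[ℂ] R, E 1 = 1 ∧ (∀ f ∈ σ.invariants, ∀ r, E (f * r) = f * E r) ∧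
      (∀ r ∈ s, E r ∈ σ.invariants) ∧ ∀ J : Ideal R, σ.IsStableIdeal J → ∀ r ∈ J, E r ∈ J := by
  classical
  -- Only the functions on `G` occurring in the coactions of the elements of `s` need to be
  -- integrated invariantly.
  choose F hF using fun r : R => exists_finite_mem_range_rTensor (σ.coact r)
  obtain ⟨l, hl1, hl⟩ := hG.exists_integral (s.biUnion F)
  refine ⟨contractLeft R l ∘ₗ σ.coact.toLinearMap, ?_, fun f hf r => ?_, fun r hr => ?_,
    fun J hJ r hr => ?_⟩
  · change contractLeft R l (σ.coact 1) = 1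
    rw [map_one, Algebra.TensorProduct.one_def, contractLeft_tmul, hl1, one_smul]
  · change contractLeft R l (σ.coact (f * r)) = f * contractLeft R l (σ.coact r)
    rw [map_mul, mem_invariants.1 hf, contractLeft_one_tmul_mul]
  · change σ.coact (contractLeft R l (σ.coact r)) = 1 ⊗ₜ contractLeft R l (σ.coact r)
    rw [← contractLeft_map, ← coassoc_apply]
    refine contractLeft_comul hl (range_rTensor_mono (Submodule.span_mono ?_) (hF r))
    exact_mod_cast Finset.subset_biUnion_of_mem F hr
  · rw [← Ideal.Quotient.eq_zero_iff_mem]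
    change Ideal.Quotient.mkₐ ℂ J (contractLeft R l (σ.coact r)) = 0
    rw [← contractLeft_map, hJ r hr, map_zero]

/-- Extension of ideals from the ring of invariants preserves properness. -/
theorem span_invariants_eq_top (hG : IsReductive H) (σ : AffineAction H R) {ι : Type*}
    (f : ι → σ.invariants) (hf : Ideal.span (Set.range fun i => (f i : R)) = ⊤) :
    Ideal.span (Set.range f) = ⊤ := by
  classical
  obtain ⟨c, hc⟩ := (Finsupp.mem_ideal_span_range_iff_exists_finsupp).1
    ((Ideal.eq_top_iff_one _).1 hf)
  obtain ⟨E, hE1, hEmul, hEinv, -⟩ := exists_reynolds hG σ (c.support.image c)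
  rw [Ideal.eq_top_iff_one]
  -- Apply the Reynolds operator to `∑ c i * f i = 1`; it is linear over invariants and fixes `1`.
  have hsum : (1 : σ.invariants) = ∑ i : c.support,
      ⟨E (c i), hEinv _ (Finset.mem_image_of_mem _ i.2)⟩ * f i := by
    refine Subtype.ext ?_
    rw [AddSubmonoidClass.coe_finsetSum]
    simp only [MulMemClass.coe_mul]
    rw [Finset.sum_coe_sort c.support (fun i => E (c i) * (f i : R)), OneMemClass.coe_one,
      ← hE1, ← hc, Finsupp.sum, map_sum]
    exact Finset.sum_congr rfl fun i _ => by rw [mul_comm, hEmul _ (f i).2, mul_comm]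
  rw [hsum]
  exact sum_mem fun i _ => Ideal.mul_mem_left _ _ (Ideal.subset_span ⟨_, rfl⟩)

/-- With `Z` the complement of `U`, take the functions on `X` whose pullback to `G × Z` under the
action vanishes. As `Z` is a union of fibres of the quotient map, the action sends `G × Z` into `Z`,
and the identity of `G` recovers `Z`. -/
theorem exists_stable_ideal (σ : AffineAction H R) {U : Set (PrimeSpectrum R)} (hU : IsOpen U)
    (hs : σ.IsSaturated U) :
    ∃ J : Ideal R, σ.IsStableIdeal J ∧ PrimeSpectrum.zeroLocus (J : Set R) = Uᶜ := by
  let I := PrimeSpectrum.vanishingIdeal Uᶜ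
  have hI : PrimeSpectrum.zeroLocus (I : Set R) = Uᶜ := by
    rw [PrimeSpectrum.zeroLocus_vanishingIdeal_eq_closure, hU.isClosed_compl.closure_eq]
  let π : H ⊗[ℂ] R →ₐ[ℂ] H ⊗[ℂ] (R ⧸ I) :=
    Algebra.TensorProduct.map (AlgHom.id ℂ H) (Ideal.Quotient.mkₐ ℂ I)
  let J : Ideal R := RingHom.ker (π.comp σ.coact)
  have hmemJ : ∀ r, r ∈ J ↔ π (σ.coact r) = 0 := fun r => Iff.rfl
  have hmk : ∀ r ∈ I, Ideal.Quotient.mkₐ ℂ I r = 0 :=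
    fun r hr => Ideal.Quotient.eq_zero_iff_mem.2 hr
  refine ⟨J, fun r hr => ?_, Set.Subset.antisymm (fun y hy => ?_) fun y hy r hr => ?_⟩
  · let j : R ⧸ J →ₐ[ℂ] H ⊗[ℂ] (R ⧸ I) := Ideal.kerLiftAlg (π.comp σ.coact)
    have hj : Function.Injective j := Ideal.kerLiftAlg_injective _
    have hj' : Function.Injective (Algebra.TensorProduct.map (AlgHom.id ℂ H) j) :=
      Module.Flat.lTensor_preserves_injective_linearMap (M := H) j.toLinearMap hj
    refine hj' ?_
    have h1 : ∀ z : H ⊗[ℂ] R, Algebra.TensorProduct.map (AlgHom.id ℂ H) j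
        (Algebra.TensorProduct.map (AlgHom.id ℂ H) (Ideal.Quotient.mkₐ ℂ J) z) =
        Algebra.TensorProduct.map (AlgHom.id ℂ H) π
          (Algebra.TensorProduct.map (AlgHom.id ℂ H) σ.coact z) := by
      intro z
      induction z with
      | zero => simp only [map_zero]
      | add x y hx hy => simp only [map_add, hx, hy]
      | tmul h x => rfl
    have h2 : ∀ z : H ⊗[ℂ] R, Algebra.TensorProduct.map (AlgHom.id ℂ H) π
        (Algebra.TensorProduct.assoc ℂ ℂ ℂ H H R (Algebra.TensorProduct.map
          (Bialgebra.comulAlgHom ℂ H) (AlgHom.id ℂ R) z)) =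
        Algebra.TensorProduct.assoc ℂ ℂ ℂ H H (R ⧸ I) (Algebra.TensorProduct.map
          (Bialgebra.comulAlgHom ℂ H) (AlgHom.id ℂ _) (π z)) := by
      intro z
      induction z with
      | zero => simp only [map_zero]
      | add x y hx hy => simp only [map_add, hx, hy]
      | tmul h x =>
        simp only [π, Algebra.TensorProduct.map_tmul, AlgHom.id_apply,
          Bialgebra.comulAlgHom_apply]
        induction Coalgebra.comul (R := ℂ) h with
        | zero => simp only [TensorProduct.zero_tmul, map_zero]
        | add a b ha hb => simp only [TensorProduct.add_tmul, map_add, ha, hb]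
        | tmul a b => rfl
    rw [h1, ← coassoc_apply, h2, (hmemJ r).1 hr]
    simp only [map_zero]
  · rw [← hI]
    intro r hr
    -- A prime of `H ⊗ (R ⧸ I)` gives a point of `G × Z`; its images under the action and the second
    -- projection lie over the same point of the quotient, so saturation puts both in `Z`. This only
    -- gives vanishing at all points, hence nilpotence, which is enough for the zero locus.
    have hnil : IsNilpotent (π (σ.coact r)) := by
      rw [nilpotent_iff_mem_prime]
      intro P hP
      let Q : PrimeSpectrum (H ⊗[ℂ] R) := PrimeSpectrum.comap π.toRingHom ⟨P, hP⟩
      have hQ : PrimeSpectrum.comap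
          (Algebra.TensorProduct.includeRight : R →ₐ[ℂ] H ⊗[ℂ] R).toRingHom Q ∉ U := by
        rw [← Set.mem_compl_iff, ← hI]
        intro i hi
        change π (1 ⊗ₜ i) ∈ P
        rw [Algebra.TensorProduct.map_tmul, hmk i hi, TensorProduct.tmul_zero]
        exact zero_mem _
      have hp : σ.quotientMap (PrimeSpectrum.comap σ.coact.toRingHom Q) =
          σ.quotientMap (PrimeSpectrum.comap
            (Algebra.TensorProduct.includeRight : R →ₐ[ℂ] H ⊗[ℂ] R).toRingHom Q) := by
        refine PrimeSpectrum.ext (Ideal.ext fun f => ?_)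
        change π (σ.coact f) ∈ P ↔ π (1 ⊗ₜ (f : R)) ∈ P
        rw [mem_invariants.1 f.2]
      have hQ' : PrimeSpectrum.comap σ.coact.toRingHom Q ∈ Uᶜ := fun hmem => hQ (by
        rw [hs, Set.mem_preimage, ← hp]
        exact Set.mem_image_of_mem _ hmem)
      rw [← hI] at hQ'
      exact hQ' hr
    obtain ⟨n, hn⟩ := hnil
    refine y.2.mem_of_pow_mem n (hy ?_)
    rw [SetLike.mem_coe, hmemJ, map_pow, map_pow, hn]
  · rw [← hI] at hy
    refine hy ?_
    -- Restricting to the identity of `G` by the counit shows `J ≤ I`.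
    have h1 : ∀ z : H ⊗[ℂ] R, contractLeft (R ⧸ I) Coalgebra.counit (π z) =
        Ideal.Quotient.mkₐ ℂ I (Algebra.TensorProduct.lid ℂ R
          (Algebra.TensorProduct.map (Bialgebra.counitAlgHom ℂ H) (AlgHom.id ℂ R) z)) := by
      intro z
      rw [contractLeft_map]
      congr 1
    have h2 := h1 (σ.coact r)
    rw [(hmemJ r).1 hr, map_zero] at h2
    have h3 : Algebra.TensorProduct.lid ℂ R (Algebra.TensorProduct.map
        (Bialgebra.counitAlgHom ℂ H) (AlgHom.id ℂ R) (σ.coact r)) = r :=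
      DFunLike.congr_fun σ.counit r
    rw [h3] at h2
    exact Ideal.Quotient.eq_zero_iff_mem.1 h2.symm

/-- A saturated open subset is a union of principal open subsets defined by invariants. -/
theorem exists_invariant_of_mem (hG : IsReductive H) (σ : AffineAction H R)
    {U : Set (PrimeSpectrum R)} (hU : IsOpen U) (hs : σ.IsSaturated U) {x : PrimeSpectrum R}
    (hx : x ∈ U) : ∃ f ∈ σ.invariants, f ∉ x.asIdeal ∧
      (PrimeSpectrum.basicOpen f : Set (PrimeSpectrum R)) ⊆ U := by
  classical
  obtain ⟨J, hJ, hJU⟩ := σ.exists_stable_ideal hU hs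
  by_contra! hcon
  -- An invariant in `J` vanishes off `U`, so if it were nonzero at `x` it would be the desired `f`.
  have hJq : ∀ f ∈ σ.invariants, f ∈ J → f ∈ x.asIdeal := by
    intro f hf hfJ
    by_contra hfx
    refine hcon f hf hfx fun y hy => ?_
    by_contra hyU
    rw [← Set.mem_compl_iff, ← hJU] at hyU
    exact hy (hyU hfJ)
  let q := (σ.quotientMap x).asIdeal
  have hq : ∀ g : σ.invariants, g ∈ q ↔ (g : R) ∈ x.asIdeal := fun g => Iff.rfl
  -- No invariant outside `q` lies in `J + qR`: the Reynolds operator fixes such an invariant, maps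
  -- its `J`-part to an invariant in `J`, which vanishes at `x`, and keeps its `qR`-part in the
  -- prime of `x`.
  have hdisj : Disjoint ((J ⊔ q.map (algebraMap σ.invariants R) : Ideal R) : Set R)
      (q.primeCompl.map (algebraMap σ.invariants R) : Submonoid R) := by
    rw [Set.disjoint_left]
    rintro _ hg ⟨g, hgq, rfl⟩
    refine hgq ?_
    obtain ⟨i, hi, t, ht, hit⟩ := Submodule.mem_sup.1 hg
    obtain ⟨E, hE1, hEmul, hEinv, hEJ⟩ := exists_reynolds hG σ {i}
    have hEi : E i ∈ x.asIdeal := hJq _ (hEinv i (Finset.mem_singleton_self i)) (hEJ J hJ i hi)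
    rw [Ideal.map, Set.image_eq_range] at ht
    obtain ⟨c, hc⟩ := Finsupp.mem_ideal_span_range_iff_exists_finsupp.1 ht
    have hEt : E t ∈ x.asIdeal := by
      rw [← hc, Finsupp.sum, map_sum]
      refine sum_mem fun v _ => ?_
      rw [mul_comm, show algebraMap σ.invariants R v = (v : σ.invariants) from rfl,
        hEmul _ v.1.2]
      exact Ideal.mul_mem_right _ _ ((hq v.1).1 v.2)
    have hEg : E (g : R) = g := by
      have := hEmul g g.2 1
      rwa [mul_one, hE1, mul_one] at this
    change (g : R) ∈ x.asIdeal
    rw [← hEg, ← show i + t = (g : R) from hit, map_add]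
    exact add_mem hEi hEt
  -- Such a prime lies over `q` and contains `J`: a point off `U` in the same fibre of the quotient
  -- map as `x`, contradicting saturation.
  obtain ⟨P, hP, hle, hPdisj⟩ := Ideal.exists_le_prime_disjoint _ _ hdisj
  have hpP : σ.quotientMap ⟨P, hP⟩ = σ.quotientMap x := by
    refine PrimeSpectrum.ext (le_antisymm (fun g hg => ?_) fun g hg => ?_)
    · by_contra hgq
      exact Set.disjoint_left.1 hPdisj hg ⟨g, hgq, rfl⟩
    · exact hle (Submodule.mem_sup_right (Ideal.mem_map_of_mem _ hg))
  have h1 : (⟨P, hP⟩ : PrimeSpectrum R) ∈ U := by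
    rw [hs, Set.mem_preimage, hpP]
    exact Set.mem_image_of_mem _ hx
  have h2 : (⟨P, hP⟩ : PrimeSpectrum R) ∈ Uᶜ := by
    rw [← hJU]
    exact fun r hr => hle (Submodule.mem_sup_left hr)
  exact h2 h1

end AffineAction

end Reynolds

/-! ### Principal open subsets inside the image of an open immersion -/

section OpenImmersion

open CategoryTheory AlgebraicGeometry

theorem IsAwayMap.of_bijective {R L T : Type*} [CommRing R] [CommRing L] [CommRing T]
    [Algebra ℂ R] [Algebra ℂ T] [Algebra R L] {f : R} [IsLocalization.Away f L]
    {ψ : R →ₐ[ℂ] T} {k : L →+* T} (hk : Function.Bijective k)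
    (hkψ : ∀ r, k (algebraMap R L r) = ψ r) : IsAwayMap ψ f where
  isUnit := by
    rw [← hkψ]
    exact (IsLocalization.Away.algebraMap_isUnit f).map k
  surj y := by
    obtain ⟨y, rfl⟩ := hk.2 y
    obtain ⟨n, a, h⟩ := IsLocalization.Away.surj f y
    exact ⟨n, a, by rw [← hkψ, ← hkψ, ← map_pow, ← map_mul, mul_comm, h]⟩
  ker x hx := by
    rw [← hkψ] at hx
    have hx' : algebraMap R L x = algebraMap R L 0 := by
      rw [map_zero]
      exact hk.1 (hx.trans (map_zero k).symm)
    obtain ⟨⟨_, n, rfl⟩, h⟩ := (IsLocalization.eq_iff_exists (Submonoid.powers f) L).1 hx'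
    exact ⟨n, by simpa using h⟩

theorem IsAwayMap.comp_bijective {A B C : Type*} [CommRing A] [CommRing B] [CommRing C]
    [Algebra ℂ A] [Algebra ℂ B] [Algebra ℂ C] {ψ : B →ₐ[ℂ] C} {e : A →ₐ[ℂ] B} {f : A}
    (h : IsAwayMap ψ (e f)) (he : Function.Bijective e) : IsAwayMap (ψ.comp e) f where
  isUnit := h.isUnit
  surj y := by
    obtain ⟨n, b, hb⟩ := h.surj y
    obtain ⟨a, rfl⟩ := he.2 b
    exact ⟨n, a, hb⟩
  ker x hx := by
    obtain ⟨n, hn⟩ := h.ker (e x) hx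
    exact ⟨n, he.1 (by rw [map_mul, map_pow, hn, map_zero])⟩

/-- If the image of the open immersion `Spec S → Spec R` contains the principal open subset `f ≠ 0`,
then `S_f = R_f`. -/
theorem IsAwayMap.of_isOpenImmersion {R S : Type v} [CommRing R] [CommRing S] [Algebra ℂ R]
    [Algebra ℂ S] (φ : R →ₐ[ℂ] S)
    (hφ : IsOpenImmersion (Spec.map (CommRingCat.ofHom φ.toRingHom))) (f : R)
    (hf : (PrimeSpectrum.basicOpen f : Set (PrimeSpectrum R)) ⊆
      Set.range (PrimeSpectrum.comap φ.toRingHom)) :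
    IsAwayMap ((IsScalarTower.toAlgHom ℂ S (Localization.Away (φ f))).comp φ) f := by
  let ψ := (IsScalarTower.toAlgHom ℂ S (Localization.Away (φ f))).comp φ
  let i₁ := Spec.map (CommRingCat.ofHom ψ.toRingHom)
  let i₂ := Spec.map (CommRingCat.ofHom (algebraMap R (Localization.Away f)))
  have e₁ : i₁ = Spec.map (CommRingCat.ofHom (algebraMap S (Localization.Away (φ f)))) ≫
      Spec.map (CommRingCat.ofHom φ.toRingHom) := by
    rw [← Spec.map_comp, ← CommRingCat.ofHom_comp]
    rfl
  have : IsOpenImmersion i₁ := by rw [e₁]; infer_instance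
  have hr₂ : Set.range i₂ = (PrimeSpectrum.basicOpen f : Set (PrimeSpectrum R)) :=
    PrimeSpectrum.localization_away_comap_range _ f
  -- Both open immersions have image `f ≠ 0`, and open immersions with equal images are isomorphic
  -- over the target; the isomorphism of spectra then comes from an isomorphism of rings.
  have hr₁ : Set.range i₁ = (PrimeSpectrum.basicOpen f : Set (PrimeSpectrum R)) := by
    have hS : Set.range (PrimeSpectrum.comap (algebraMap S (Localization.Away (φ f)))) =
      PrimeSpectrum.basicOpen (φ f) := PrimeSpectrum.localization_away_comap_range _ (φ f)
    have hcr : Set.range i₁ = PrimeSpectrum.comap φ.toRingHom ''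
        (PrimeSpectrum.basicOpen (φ f) : Set (PrimeSpectrum S)) := by
      rw [← hS, ← Set.range_comp]
      rfl
    rw [hcr]
    refine Set.Subset.antisymm ?_ fun x hx => ?_
    · rintro _ ⟨y, hy, rfl⟩
      exact hy
    · obtain ⟨y, rfl⟩ := hf hx
      exact ⟨y, hx, rfl⟩
  let e := IsOpenImmersion.isoOfRangeEq i₁ i₂ (hr₁.trans hr₂.symm)
  have he : e.hom ≫ i₂ = i₁ := IsOpenImmersion.isoOfRangeEq_hom_fac _ _ _
  let k := Spec.preimage e.hom
  have hk : Spec.map k = e.hom := Spec.map_preimage _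
  have : IsIso (Spec.map k) := by rw [hk]; infer_instance
  have : IsIso (Scheme.Spec.map k.op) := this
  have : IsIso k.op := isIso_of_reflects_iso k.op Scheme.Spec
  have : IsIso k := (isIso_op_iff k).1 this
  have hfac : CommRingCat.ofHom (algebraMap R (Localization.Away f)) ≫ k =
      CommRingCat.ofHom ψ.toRingHom := by
    apply Spec.map_injective
    rw [Spec.map_comp, hk]
    exact he
  refine IsAwayMap.of_bijective (L := Localization.Away f) (k := k.hom)
    (ConcreteCategory.bijective_of_isIso k) fun r => ?_
  exact DFunLike.congr_fun (congrArg CommRingCat.Hom.hom hfac) r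

end OpenImmersion

/-! ### Properties local on the quotient, and saturated covers -/

namespace AffineAction

variable {H : Type u} [CommRing H] [HopfAlgebra ℂ H]

theorem IsEquivariant.comp {R S T : Type*} [CommRing R] [Algebra ℂ R] [CommRing S] [Algebra ℂ S]
    [CommRing T] [Algebra ℂ T] {σ : AffineAction H R} {τ : AffineAction H S}
    {υ : AffineAction H T} {φ : R →ₐ[ℂ] S} {χ : S →ₐ[ℂ] T} (hχ : τ.IsEquivariant υ χ)
    (hφ : σ.IsEquivariant τ φ) : σ.IsEquivariant υ (χ.comp φ) := by
  refine AlgHom.ext fun r => ?_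
  rw [AlgHom.comp_apply, AlgHom.comp_apply, hχ.apply, hφ.apply, AlgHom.comp_apply,
    ← AlgHom.comp_apply, ← Algebra.TensorProduct.map_comp, AlgHom.comp_id]

theorem isEquivariant_localizeAway {R : Type*} [CommRing R] [Algebra ℂ R] (σ : AffineAction H R)
    {f : R} (hf : f ∈ σ.invariants) : σ.IsEquivariant (σ.localizeAway f hf)
      (IsScalarTower.toAlgHom ℂ R (Localization.Away f)) :=
  AlgHom.ext fun r => by
    have h : IsLocalization.liftAlgHom (M := Submonoid.powers f) (σ.isUnit_coact hf)
        (algebraMap R (Localization.Away f) r) = Algebra.TensorProduct.map (AlgHom.id ℂ H)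
          (IsScalarTower.toAlgHom ℂ R (Localization.Away f)) (σ.coact r) :=
      IsLocalization.lift_eq (σ.isUnit_coact hf) r
    exact h

theorem isAway_localizeAway {R : Type*} [CommRing R] [Algebra ℂ R] (σ : AffineAction H R)
    {f : R} (hf : f ∈ σ.invariants) : σ.IsAway (σ.localizeAway f hf)
      (IsScalarTower.toAlgHom ℂ R (Localization.Away f)) f :=
  ⟨σ.isEquivariant_localizeAway hf, hf, IsAwayMap.of_isLocalization f⟩

/-- Properties of affine `G`-varieties which are local on the quotient. -/
structure IsLocalOnQuotient
    (P : ∀ (R : Type v) [CommRing R] [Algebra ℂ R], AffineAction H R → Prop) : Prop where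
  of_isAway {R : Type v} [CommRing R] [Algebra ℂ R] {T : Type v} [CommRing T] [Algebra ℂ T]
    {σ : AffineAction H R} {τ : AffineAction H T} {ψ : R →ₐ[ℂ] T} {f : R} :
    σ.IsAway τ ψ f → P R σ → P T τ
  of_cover {R : Type v} [CommRing R] [Algebra ℂ R] {σ : AffineAction H R} {ι : Type v}
    {T : ι → Type v} [∀ i, CommRing (T i)] [∀ i, Algebra ℂ (T i)]
    {τ : ∀ i, AffineAction H (T i)} {ψ : ∀ i, R →ₐ[ℂ] T i} {f : ι → R}
    (h : ∀ i, σ.IsAway (τ i) (ψ i) (f i)) :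
    Ideal.span (Set.range fun i => (⟨f i, (h i).mem⟩ : σ.invariants)) = ⊤ →
    (∀ i, P (T i) (τ i)) → P R σ

theorem isLocalOnQuotient_isGood (m : ℕ∞) :
    IsLocalOnQuotient.{u, v} (H := H) fun _ _ _ σ => σ.IsGood m :=
  ⟨fun h => h.isGood, fun h hf => isGood_of_cover h hf⟩

theorem isLocalOnQuotient_isVeryGood (m : ℕ∞) :
    IsLocalOnQuotient.{u, v} (H := H) fun _ _ _ σ => σ.IsVeryGood m :=
  ⟨fun h => h.isVeryGood, fun h hf => isVeryGood_of_cover h hf⟩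

theorem isLocalOnQuotient_isDFinite :
    IsLocalOnQuotient.{u, v} (H := H) fun _ _ _ σ => σ.IsDFinite :=
  ⟨fun h => h.isDFinite, fun h hf => isDFinite_of_cover h hf⟩

theorem span_eq_top_of_forall_prime {R ι : Type*} [CommRing R] {f : ι → R}
    (h : ∀ x : PrimeSpectrum R, ∃ i, f i ∉ x.asIdeal) : Ideal.span (Set.range f) = ⊤ := by
  by_contra hne
  obtain ⟨M, hM, hle⟩ := Ideal.exists_le_maximal _ hne
  obtain ⟨i, hi⟩ := h ⟨M, hM.isPrime⟩
  exact hi (hle (Ideal.subset_span ⟨i, rfl⟩))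

/-- Let `f` be an invariant with `X_f` inside the image of the `α`-th chart. Then the localization
of `S α` at `φ α f` is a principal open subset of both `X` and the chart. Such sets cover the chart
for fixed `α`, and cover `X` as `α` varies, so the property transfers through them in both
directions. -/
theorem IsLocalOnQuotient.iff_of_saturated_cover
    {P : ∀ (R : Type v) [CommRing R] [Algebra ℂ R], AffineAction H R → Prop}
    (hP : IsLocalOnQuotient P) (hG : IsReductive H) {R : Type v} [CommRing R] [Algebra ℂ R]
    (X : AffineAction H R) {ι : Type*} {S : ι → Type v} [∀ α, CommRing (S α)]
    [∀ α, Algebra ℂ (S α)] (U : ∀ α, AffineAction H (S α)) (φ : ∀ α, R →ₐ[ℂ] S α)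
    (h : ∀ α, X.IsSaturatedOpen (U α) (φ α))
    (hcover : (⋃ α, Set.range (PrimeSpectrum.comap (φ α).toRingHom)) = Set.univ) :
    P R X ↔ ∀ α, P (S α) (U α) := by
  let K (α : ι) : Set R := {f | f ∈ X.invariants ∧
    (PrimeSpectrum.basicOpen f : Set (PrimeSpectrum R)) ⊆
      Set.range (PrimeSpectrum.comap (φ α).toRingHom)}
  have hK : ∀ α, ∀ x ∈ Set.range (PrimeSpectrum.comap (φ α).toRingHom), ∃ f ∈ K α,
      f ∉ x.asIdeal := by
    intro α x hx
    have hopen : IsOpen (Set.range (PrimeSpectrum.comap (φ α).toRingHom)) :=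
      (h α).isOpenImmersion.base_open.isOpen_range
    obtain ⟨f, hf, hfx, hle⟩ := exists_invariant_of_mem hG X hopen (h α).saturated hx
    exact ⟨f, ⟨hf, hle⟩, hfx⟩
  have hmem : ∀ α, ∀ f ∈ K α, φ α f ∈ (U α).invariants :=
    fun α f hf => (h α).equivariant.map_mem_invariants hf.1
  have hX : ∀ α f (hf : f ∈ K α), X.IsAway ((U α).localizeAway (φ α f) (hmem α f hf))
      ((IsScalarTower.toAlgHom ℂ (S α) (Localization.Away (φ α f))).comp (φ α)) f :=
    fun α f hf => ⟨((U α).isEquivariant_localizeAway (hmem α f hf)).comp (h α).equivariant, hf.1,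
      IsAwayMap.of_isOpenImmersion (φ α) (h α).isOpenImmersion f hf.2⟩
  constructor
  · intro hPX α
    refine hP.of_cover (ι := K α) (fun f => (U α).isAway_localizeAway (hmem α f f.2)) ?_
      fun f => hP.of_isAway (hX α f f.2) hPX
    refine span_invariants_eq_top hG (U α) _ (span_eq_top_of_forall_prime fun y => ?_)
    obtain ⟨f, hf, hfy⟩ := hK α _ ⟨y, rfl⟩
    exact ⟨⟨f, hf⟩, hfy⟩
  · intro hPU
    -- The cover is indexed by functions, with a chosen chart for each, and not by pairs: `ι` may
    -- live in any universe, whereas `of_cover` needs an index type in that of `R`.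
    choose a ha using fun f : {f : R // ∃ α, f ∈ K α} => f.2
    refine hP.of_cover (ι := {f : R // ∃ α, f ∈ K α}) (fun f => hX (a f) f (ha f)) ?_
      fun f => hP.of_isAway ((U (a f)).isAway_localizeAway (hmem (a f) f (ha f))) (hPU (a f))
    refine span_invariants_eq_top hG X _ (span_eq_top_of_forall_prime fun x => ?_)
    obtain ⟨α, hα⟩ := Set.mem_iUnion.1 (hcover.symm ▸ Set.mem_univ x)
    obtain ⟨f, hf, hfx⟩ := hK α x hα
    exact ⟨⟨f, α, hf⟩, hfx⟩

end AffineAction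

/-! ### Scalar multiplication on a module -/

section Scaling

variable {W : Type v} [AddCommGroup W] [Module ℂ W]

/-- The automorphism `F ↦ F (c ·)` of the ring of polynomial functions. -/
def PolyFun.scale (W : Type v) [AddCommGroup W] [Module ℂ W] (c : ℂ) : PolyFun W →ₐ[ℂ] PolyFun W :=
  SymmetricAlgebra.lift (c • SymmetricAlgebra.ι ℂ (Module.Dual ℂ W))

theorem PolyFun.scale_ι (c : ℂ) (ξ : Module.Dual ℂ W) :
    scale W c (SymmetricAlgebra.ι ℂ _ ξ) = c • SymmetricAlgebra.ι ℂ _ ξ :=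
  SymmetricAlgebra.lift_ι_apply _ ξ

theorem PolyFun.scale_scale (c d : ℂ) (f : PolyFun W) :
    scale W c (scale W d f) = scale W (c * d) f := by
  have : (scale W c).comp (scale W d) = scale W (c * d) :=
    SymmetricAlgebra.algHom_ext (LinearMap.ext fun ξ => by
      change scale W c (scale W d (SymmetricAlgebra.ι ℂ _ ξ)) =
        scale W (c * d) (SymmetricAlgebra.ι ℂ _ ξ)
      rw [scale_ι, map_smul, scale_ι, scale_ι, smul_smul, mul_comm])
  exact DFunLike.congr_fun this f

theorem PolyFun.scale_one (f : PolyFun W) : scale W 1 f = f := by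
  have : scale W 1 = AlgHom.id ℂ _ :=
    SymmetricAlgebra.algHom_ext (LinearMap.ext fun ξ => by
      change scale W 1 (SymmetricAlgebra.ι ℂ _ ξ) = SymmetricAlgebra.ι ℂ _ ξ
      rw [scale_ι, one_smul])
  exact DFunLike.congr_fun this f

theorem PolyFun.scale_zero (f : PolyFun W) :
    scale W 0 f = algebraMap ℂ _ (PolyFun.eval (0 : W) f) := by
  have : scale W 0 = (Algebra.ofId ℂ _).comp (PolyFun.eval (0 : W)) :=
    SymmetricAlgebra.algHom_ext (LinearMap.ext fun ξ => by
      change scale W 0 (SymmetricAlgebra.ι ℂ _ ξ) =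
        algebraMap ℂ _ (PolyFun.eval (0 : W) (SymmetricAlgebra.ι ℂ _ ξ))
      rw [scale_ι, zero_smul, PolyFun.eval, SymmetricAlgebra.lift_ι_apply]
      simp)
  exact DFunLike.congr_fun this f

theorem PolyFun.bijective_scale {c : ℂ} (hc : c ≠ 0) : Function.Bijective (scale W c) :=
  Function.bijective_iff_has_inverse.2 ⟨scale W c⁻¹,
    fun f => by rw [scale_scale, inv_mul_cancel₀ hc, scale_one],
    fun f => by rw [scale_scale, mul_inv_cancel₀ hc, scale_one]⟩

open Polynomial in
theorem PolyFun.exists_polynomial (f : PolyFun W) :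
    ∃ p : (PolyFun W)[X], ∀ c : ℂ, p.eval (algebraMap ℂ _ c) = scale W c f := by
  -- `Θ` is scaling by an indeterminate: it sends each linear form `ξ` to `ξ` times `X`.
  let Θ : PolyFun W →ₐ[ℂ] (PolyFun W)[X] := SymmetricAlgebra.lift
    (LinearMap.mulLeft ℂ X ∘ₗ (CAlgHom (R := ℂ)).toLinearMap ∘ₗ SymmetricAlgebra.ι ℂ _)
  refine ⟨Θ f, fun c => ?_⟩
  have : ((Polynomial.aeval (R := PolyFun W) (algebraMap ℂ (PolyFun W) c)).restrictScalars ℂ).comp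
      Θ = scale W c := SymmetricAlgebra.algHom_ext (LinearMap.ext fun ξ => by
    change Polynomial.aeval (algebraMap ℂ (PolyFun W) c) (Θ (SymmetricAlgebra.ι ℂ _ ξ)) =
      scale W c (SymmetricAlgebra.ι ℂ _ ξ)
    rw [scale_ι, SymmetricAlgebra.lift_ι_apply]
    simp only [Algebra.smul_def, LinearMap.comp_apply, LinearMap.mulLeft_apply, map_mul,
      AlgHom.toLinearMap_apply, CAlgHom_apply, aeval_X, aeval_C]
    rfl)
  rw [← this]
  simp

/-- The open subsets `f (c w) ≠ 0` with `c ≠ 0` cover `W` if `f 0 ≠ 0`. -/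
theorem PolyFun.exists_scale_notMem {f : PolyFun W} (hf : PolyFun.eval (0 : W) f ≠ 0)
    (x : PrimeSpectrum (PolyFun W)) : ∃ c : ℂˣ, scale W c f ∉ x.asIdeal := by
  by_contra! h
  obtain ⟨p, hp⟩ := exists_polynomial f
  let κ := PolyFun W ⧸ x.asIdeal
  let q : Polynomial κ := p.map (Ideal.Quotient.mk x.asIdeal)
  have hq : ∀ c : ℂ, q.eval (algebraMap ℂ κ c) = Ideal.Quotient.mk x.asIdeal (scale W c f) :=
    fun c => by
      rw [← hp]
      exact Polynomial.eval_map_apply (Ideal.Quotient.mk x.asIdeal) (algebraMap ℂ (PolyFun W) c)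
  have hinj : Function.Injective (algebraMap ℂ κ) := (algebraMap ℂ κ).injective
  -- Over the domain `κ`, a polynomial vanishing at the infinitely many nonzero constants is zero,
  -- so its value at `0`, the class of `f(0)`, vanishes too.
  have hq0 : q = 0 := by
    refine Polynomial.eq_zero_of_infinite_isRoot q ?_
    refine ((Set.finite_singleton (0 : ℂ)).infinite_compl.image hinj.injOn).mono ?_
    rintro _ ⟨c, hc, rfl⟩
    exact (hq c).trans (Ideal.Quotient.eq_zero_iff_mem.2 (h (Units.mk0 c hc)))
  have h0 := hq 0
  rw [hq0, Polynomial.eval_zero, scale_zero] at h0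
  exact hf (hinj (h0.symm.trans (map_zero _).symm))

variable {H : Type u} [CommRing H] [HopfAlgebra ℂ H] [FiniteDimensional ℂ W]

theorem Rep.isEquivariant_scale (ρ : Rep H W) (c : ℂ) :
    ρ.toAffineAction.IsEquivariant ρ.toAffineAction (PolyFun.scale W c) := by
  refine SymmetricAlgebra.algHom_ext (LinearMap.ext fun ξ => ?_)
  change ρ.toAffineAction.coact (PolyFun.scale W c (SymmetricAlgebra.ι ℂ _ ξ)) =
    Algebra.TensorProduct.map (AlgHom.id ℂ H) (PolyFun.scale W c)
      (ρ.toAffineAction.coact (SymmetricAlgebra.ι ℂ _ ξ))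
  have hι : ρ.toAffineAction.coact (SymmetricAlgebra.ι ℂ _ ξ) =
      (SymmetricAlgebra.ι ℂ (Module.Dual ℂ W)).lTensor H (ρ.dualCoact ξ) :=
    SymmetricAlgebra.lift_ι_apply _ ξ
  rw [PolyFun.scale_ι, map_smul, hι]
  induction ρ.dualCoact ξ with
  | zero => simp
  | add x y hx hy => simp only [map_add, smul_add, hx, hy]
  | tmul h η =>
    rw [LinearMap.lTensor_tmul, Algebra.TensorProduct.map_tmul, PolyFun.scale_ι,
      TensorProduct.tmul_smul, AlgHom.id_apply]

/-- The loci `f(cw) ≠ 0` with `c ≠ 0` cover `W`, and each is a copy of `W_f`, so one ring with its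
action serves as every chart. -/
theorem AffineAction.IsLocalOnQuotient.iff_localizeAway
    {P : ∀ (R : Type v) [CommRing R] [Algebra ℂ R], AffineAction H R → Prop}
    (hP : IsLocalOnQuotient P) (hG : IsReductive H) (ρ : Rep H W) {f : PolyFun W}
    (hf : f ∈ ρ.toAffineAction.invariants) (h0 : PolyFun.eval (0 : W) f ≠ 0) :
    P _ ρ.toAffineAction ↔ P _ (ρ.toAffineAction.localizeAway f hf) := by
  have hloc := ρ.toAffineAction.isAway_localizeAway hf
  refine ⟨hP.of_isAway hloc, fun h => ?_⟩
  -- Precomposing the localization map with scaling by `c⁻¹` carries `f(c ·)` back to `f`, so the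
  -- same target now inverts `f(c ·)`. The lift puts the index type in the universe of `W`.
  have haway : ∀ c : ULift.{v} ℂˣ, ρ.toAffineAction.IsAway (ρ.toAffineAction.localizeAway f hf)
      ((IsScalarTower.toAlgHom ℂ _ (Localization.Away f)).comp
        (PolyFun.scale W ((c.down⁻¹ : ℂˣ) : ℂ))) (PolyFun.scale W (c.down : ℂ) f) := fun c => by
    refine ⟨hloc.equivariant.comp (ρ.isEquivariant_scale _),
      (ρ.isEquivariant_scale _).map_mem_invariants hf, IsAwayMap.comp_bijective ?_
        (PolyFun.bijective_scale (Units.ne_zero _))⟩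
    rw [PolyFun.scale_scale, Units.inv_mul, PolyFun.scale_one]
    exact hloc.away
  refine hP.of_cover haway ?_ fun _ => h
  refine span_invariants_eq_top hG _ _ (span_eq_top_of_forall_prime fun x => ?_)
  obtain ⟨c, hc⟩ := PolyFun.exists_scale_notMem h0 x
  exact ⟨⟨c⟩, hc⟩

end Scaling

end JetInvariant

end

theorem mainTheorem12 {H : Type*} [CommRing H] [HopfAlgebra ℂ H] [Algebra.FiniteType ℂ H]
    (hG : JetInvariant.IsReductive H) :
    (∀ {R : Type*} [CommRing R] [Algebra ℂ R] [Algebra.FiniteType ℂ R]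
      (X : JetInvariant.AffineAction H R) {ι : Type*} (S : ι → Type _)
      [∀ α, CommRing (S α)] [∀ α, Algebra ℂ (S α)]
      (U : ∀ α, JetInvariant.AffineAction H (S α)) (φ : ∀ α, R →ₐ[ℂ] S α),
      (∀ α, X.IsSaturatedOpen (U α) (φ α)) →
      (⋃ α, Set.range (PrimeSpectrum.comap (φ α).toRingHom)) = Set.univ →
        (∀ m : ℕ∞, X.IsVeryGood m ↔ ∀ α, (U α).IsVeryGood m) ∧
        (∀ m : ℕ∞, X.IsGood m ↔ ∀ α, (U α).IsGood m) ∧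
        (X.IsDFinite ↔ ∀ α, (U α).IsDFinite)) ∧
    (∀ {W : Type*} [AddCommGroup W] [Module ℂ W] [FiniteDimensional ℂ W]
      (ρ : JetInvariant.Rep H W) (f : JetInvariant.PolyFun W)
      (hf : f ∈ ρ.toAffineAction.invariants), JetInvariant.PolyFun.eval (0 : W) f ≠ 0 →
        (∀ m : ℕ∞, ρ.toAffineAction.IsVeryGood m ↔
          (ρ.toAffineAction.localizeAway f hf).IsVeryGood m) ∧
        (∀ m : ℕ∞, ρ.toAffineAction.IsGood m ↔
          (ρ.toAffineAction.localizeAway f hf).IsGood m) ∧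
        (ρ.toAffineAction.IsDFinite ↔ (ρ.toAffineAction.localizeAway f hf).IsDFinite)) := by
  refine ⟨fun {R} _ _ _ X ι S _ _ U φ h hcover => ⟨fun m => ?_, fun m => ?_, ?_⟩,
    fun {W} _ _ _ ρ f hf h0 => ⟨fun m => ?_, fun m => ?_, ?_⟩⟩
  · exact (JetInvariant.AffineAction.isLocalOnQuotient_isVeryGood m).iff_of_saturated_cover
      hG X U φ h hcover
  · exact (JetInvariant.AffineAction.isLocalOnQuotient_isGood m).iff_of_saturated_cover
      hG X U φ h hcover
  · exact JetInvariant.AffineAction.isLocalOnQuotient_isDFinite.iff_of_saturated_cover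
      hG X U φ h hcover
  · exact (JetInvariant.AffineAction.isLocalOnQuotient_isVeryGood m).iff_localizeAway hG ρ hf h0
  · exact (JetInvariant.AffineAction.isLocalOnQuotient_isGood m).iff_localizeAway hG ρ hf h0
  · exact JetInvariant.AffineAction.isLocalOnQuotient_isDFinite.iff_localizeAway hG ρ hf h0
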